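/- For integers $k\ge 1$, $q\ge 1$ let $W_{k,q}=\{v\in\mathbb Z^{k-1}: 0\le v_1\le\cdots\le v_{k-1}\le q\}$. The edgewise subdivision $T_{k,q}$ is the simplicial complex on $W_{k,q}$ whose facets are the sets $$F(v,\pi)=\{v,\ v+e_{\pi_{k-1}},\ v+e_{\pi_{k-1}}+e_{\pi_{k-2}},\ \ldots,\ v+e_{\pi_{k-1}}+\cdots+e_{\pi_1}=v+\mathbb 1\},$$ where $v$ and $v+\mathbb 1$ lie in $W_{k,q}$ and $\pi$ is a permutation of $\{1,\ldots,k-1\}$ in which $i$ occurs before $i+1$ whenever $v_i=v_{i+1}$. The link of a face $\sigma$ of a complex $K$ consists of the faces $\tau$ with $\sigma\cup\tau\in K$ and $\sigma\cap\tau=\emptyset$. Two complexes have the same combinatorial type if some bijection between their vertex sets maps faces exactly to faces. For a partition $\sigma=(\sigma_1,\ldots,\sigma_r)$ of a positive integer let $K_\sigma$ be the complex of chains of the poset obtained from the product of chains $\{0,\ldots,\sigma_1\}\times\cdots\times\{0,\ldots,\sigma_r\}$ by removing its minimum and its maximum. For $s\ge 0$ let $Q_s$ be the number of combinatorial types of $s$-dimensional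 complexes that are joins of finitely many complexes $K_\sigma$, where each partition $\sigma$ has at least two parts. Theorem. For every integer $m\ge 0$, the number of combinatorial types of links of $m$-dimensional faces of $T_{2m+2,2m+2}$ is $$Q_m+Q_{m-1}+\cdots+Q_1+Q_0+1.$$ Moreover, for every $s\ge 0$, $$Q_s=\sum_{\mu}\ \prod_{i=1}^{j}\left(\!\!\binom{p_{n_i+1}-1}{m_i}\!\!\right),$$ where the sum is over all partitions $\mu=(n_1^{m_1},\ldots,n_j^{m_j})$ of $s+1$ (distinct parts $n_1,\ldots,n_j$ with multiplicities $m_1,\ldots,m_j\ge 1$), $p_n$ is the number of partitions of $n$, and $\left(\!\binom{a}{b}\!\right)=\binom{a+b-1}{b}$ is the number of multisets of size $b$ from a set of $a$ elements. -/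

import Mathlib

/-! ### Abstract simplicial complexes up to combinatorial equivalence

Complexes are Mathlib's `PreAbstractSimplicialComplex`: the faces are the nonempty ones, and not
every element of the ambient type has to be a vertex. -/

namespace EdgewiseSubdivision

/-- The vertices of a complex. -/
def vertexSet {V : Type*} (K : PreAbstractSimplicialComplex V) : Set V :=
  {v | ({v} : Finset V) ∈ K.faces}

/-- Two complexes are combinatorially equivalent if there is a bijection between their vertices
that maps faces exactly to faces. -/
def CombEquiv {V W : Type*} (K : PreAbstractSimplicialComplex V)
    (L : PreAbstractSimplicialComplex W) : Prop :=
  ∃ f : vertexSet K ≃ vertexSet L, ∀ s : Finset (vertexSet K),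
    s.map (Function.Embedding.subtype _) ∈ K.faces ↔
      (s.map f.toEmbedding).map (Function.Embedding.subtype _) ∈ L.faces

theorem CombEquiv.refl {V : Type*} (K : PreAbstractSimplicialComplex V) : CombEquiv K K :=
  ⟨Equiv.refl _, fun s => by simp⟩

theorem CombEquiv.symm {V W : Type*} {K : PreAbstractSimplicialComplex V}
    {L : PreAbstractSimplicialComplex W} (h : CombEquiv K L) : CombEquiv L K := by
  obtain ⟨f, hf⟩ := h
  refine ⟨f.symm, fun s => ?_⟩
  have h1 := hf (s.map f.symm.toEmbedding)
  have h2 : (s.map f.symm.toEmbedding).map f.toEmbedding = s := by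
    ext x
    simp
  rw [h2] at h1
  exact h1.symm

theorem CombEquiv.trans {U V W : Type*} {K : PreAbstractSimplicialComplex U}
    {L : PreAbstractSimplicialComplex V} {M : PreAbstractSimplicialComplex W}
    (h : CombEquiv K L) (h' : CombEquiv L M) : CombEquiv K M := by
  obtain ⟨f, hf⟩ := h
  obtain ⟨g, hg⟩ := h'
  refine ⟨f.trans g, fun s => ?_⟩
  have h2 : (s.map f.toEmbedding).map g.toEmbedding = s.map (f.trans g).toEmbedding := by
    rw [Finset.map_map]
    rfl
  rw [hf s, hg (s.map f.toEmbedding), h2]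

/-- Combinatorial equivalence as a setoid on all complexes (on vertices in any `Type`). -/
def complexSetoid : Setoid (Σ V : Type, PreAbstractSimplicialComplex V) where
  r K L := CombEquiv K.2 L.2
  iseqv := ⟨fun K => CombEquiv.refl K.2, CombEquiv.symm, CombEquiv.trans⟩

/-- Combinatorial types of simplicial complexes. -/
def CombType : Type 1 := Quotient complexSetoid

/-- The combinatorial type of a complex. -/
def combType {V : Type} (K : PreAbstractSimplicialComplex V) : CombType :=
  Quotient.mk complexSetoid ⟨V, K⟩

/-- `K` is `d`-dimensional: the largest cardinality of a face is `d + 1`. -/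
def HasDim {V : Type*} (K : PreAbstractSimplicialComplex V) (d : ℕ) : Prop :=
  IsGreatest (Finset.card '' K.faces) (d + 1)

/-! ### Links, joins, order complexes -/

/-- The link of a face `σ`: all faces `τ` with `σ ∪ τ` a face and `σ ∩ τ = ∅`. -/
def link {V : Type*} [DecidableEq V] (K : PreAbstractSimplicialComplex V) (σ : Finset V) :
    PreAbstractSimplicialComplex V where
  faces := {τ | τ ∈ K.faces ∧ σ ∪ τ ∈ K.faces ∧ Disjoint σ τ}
  isRelLowerSet_faces := by
    rintro τ ⟨h1, h2, h3⟩
    refine ⟨(K.isRelLowerSet_faces h1).1, fun ρ hρ hne => ⟨?_, ?_, ?_⟩⟩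
    · exact (K.isRelLowerSet_faces h1).2 hρ hne
    · exact (K.isRelLowerSet_faces h2).2 (Finset.union_subset_union_right hρ)
        (hne.mono Finset.subset_union_right)
    · exact h3.mono_right hρ

/-- The join of a family of complexes: its faces are the nonempty finite subsets of the disjoint
union of the vertices whose part in each complex is empty or a face. -/
def join {ι : Type*} {V : ι → Type*} (K : ∀ i, PreAbstractSimplicialComplex (V i)) :
    PreAbstractSimplicialComplex (Σ i, V i) where
  faces := {s | s.Nonempty ∧ ∀ i,
    s.preimage (Sigma.mk i) sigma_mk_injective.injOn = ∅ ∨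
      s.preimage (Sigma.mk i) sigma_mk_injective.injOn ∈ (K i).faces}
  isRelLowerSet_faces := by
    rintro s ⟨hs, h⟩
    refine ⟨hs, fun t hts hne => ⟨hne, fun i => ?_⟩⟩
    have hsub : t.preimage (Sigma.mk i) sigma_mk_injective.injOn ⊆
        s.preimage (Sigma.mk i) sigma_mk_injective.injOn := by
      intro x hx
      rw [Finset.mem_preimage] at hx ⊢
      exact hts hx
    rcases Finset.eq_empty_or_nonempty
      (t.preimage (Sigma.mk i) sigma_mk_injective.injOn) with h0 | h0
    · exact Or.inl h0
    · rcases h i with h1 | h1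
      · rw [h1, Finset.subset_empty] at hsub
        exact Or.inl hsub
      · exact Or.inr (((K i).isRelLowerSet_faces h1).2 hsub h0)

/-- The order complex of a poset: the faces are the nonempty finite chains. -/
def orderComplex (P : Type*) [PartialOrder P] : PreAbstractSimplicialComplex P where
  faces := {s | s.Nonempty ∧ IsChain (· ≤ ·) (s : Set P)}
  isRelLowerSet_faces := by
    rintro s ⟨hs, h⟩
    exact ⟨hs, fun t hts hne => ⟨hne, h.mono (Finset.coe_subset.2 hts)⟩⟩

/-- The reduced order complex of a bounded poset: the order complex of the poset without its
minimum and its maximum. -/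
def reducedOrderComplex (P : Type*) [PartialOrder P] [BoundedOrder P] :
    PreAbstractSimplicialComplex {x : P // x ≠ ⊥ ∧ x ≠ ⊤} :=
  orderComplex {x : P // x ≠ ⊥ ∧ x ≠ ⊤}

/-- The product of chains `C_{λ₁} × ⋯ × C_{λₛ}` of a partition `λ`, where `C_a` is the chain
`{0, …, a}` of length `a`; the factors are indexed by the parts, with multiplicity. -/
abbrev ChainProduct {k : ℕ} (p : k.Partition) : Type :=
  ∀ i : p.parts.ToType, Fin (i.1 + 1)

/-- The complex `K_λ`: the reduced order complex of the product of chains of `λ`. -/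
def partitionComplex {k : ℕ} (p : k.Partition) :
    PreAbstractSimplicialComplex {x : ChainProduct p // x ≠ ⊥ ∧ x ≠ ⊤} :=
  reducedOrderComplex (ChainProduct p)

/-! ### The edgewise subdivision `T_{k,q}` -/

/-- The vertex set `W_{k,q}`: integer points with `0 ≤ v₁ ≤ ⋯ ≤ v_{k-1} ≤ q`. -/
def vertices (k q : ℕ) : Set (Fin (k - 1) → ℤ) :=
  {v | Monotone v ∧ ∀ i, 0 ≤ v i ∧ v i ≤ q}

/-- The permutation `π = π₁ ⋯ π_{k-1}` is consistent with `v` if `i` is before `i + 1` in `π`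
whenever `vᵢ = vᵢ₊₁`; `π.symm i` is the position of `i` in `π`. -/
def Consistent {k : ℕ} (v : Fin (k - 1) → ℤ) (π : Equiv.Perm (Fin (k - 1))) : Prop :=
  ∀ i j : Fin (k - 1), (j : ℕ) = i + 1 → v i = v j → π.symm i < π.symm j

/-- The vertices of `F(v, π)`: the points `v`, `v + e_{π_{k-1}}`, …,
`v + e_{π_{k-1}} + ⋯ + e_{π₁} = v + 𝟙`. The point with index `a` is the one in which exactly
the coordinates at the positions `≥ a` of `π` (counted from `0`) have been increased. -/
def facet {k : ℕ} (v : Fin (k - 1) → ℤ) (π : Equiv.Perm (Fin (k - 1))) :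
    Finset (Fin (k - 1) → ℤ) :=
  (Finset.range (k - 1 + 1)).image
    fun a => fun c => v c + if a ≤ (π.symm c : ℕ) then 1 else 0

/-- The edgewise subdivision `T_{k,q}`, as an abstract complex: its facets are the `F(v, π)` with
`π` consistent with `v`, the first vertex `v` and the last vertex `v + 𝟙` being in `W_{k,q}`. -/
def edgewise (k q : ℕ) : PreAbstractSimplicialComplex (Fin (k - 1) → ℤ) where
  faces := {s | s.Nonempty ∧ ∃ (v : Fin (k - 1) → ℤ) (π : Equiv.Perm (Fin (k - 1))),
    v ∈ vertices k q ∧ v + 1 ∈ vertices k q ∧ Consistent v π ∧ s ⊆ facet v π}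
  isRelLowerSet_faces := by
    rintro s ⟨hs, v, π, h1, h2, h3, h4⟩
    exact ⟨hs, fun t hts hne => ⟨hne, v, π, h1, h2, h3, hts.trans h4⟩⟩

/-! ### The counted sets -/

/-- The combinatorial types of the links of the `d`-dimensional faces of `T_{k,q}`. -/
def linkTypes (k q d : ℕ) : Set CombType :=
  {c | ∃ σ ∈ (edgewise k q).faces, σ.card = d + 1 ∧ c = combType (link (edgewise k q) σ)}

/-- The combinatorial types of the `s`-dimensional complexes that are joins of finitely many
complexes `K_σ` for partitions `σ` with at least two parts. -/
def joinTypes (s : ℕ) : Set CombType :=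
  {c | ∃ (r : ℕ) (n : Fin r → ℕ) (σ : ∀ i, (n i).Partition),
    (∀ i, 2 ≤ (σ i).parts.card) ∧
    HasDim (join fun i => partitionComplex (σ i)) s ∧
    c = combType (join fun i => partitionComplex (σ i))}

/-- The number `Q_s`. -/
noncomputable def Q (s : ℕ) : ℕ∞ := (joinTypes s).encard

end EdgewiseSubdivision

/-! Lift a vertex of $T_{k,q}$ to integers $x_0\le\cdots\le x_{k-1}\le x_0+q$, unique up to adding a
common constant. The vertices near it arise by raising a proper subset of the coordinates by one,
and the result is again a lift exactly when the subset is an up-set, in a suitable linear order,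
within every residue class mod $q$ (`isLift_raise_iff`). Two such vertices are joined by an edge
exactly when the subsets are nested. Since $T_{k,q}$ is a flag complex (`mem_edgewise_faces_iff`),
the star of the vertex is the complex of chains of a product of chains without its maximum
(`exists_star_equiv`); the chain lengths are the sizes of the residue classes and sum to $k$.

A face with $m+1$ vertices through this vertex is a chain starting at `⊥`. Together with `⊤` it has
$m+1$ gaps, and the link consists of the elements inside the gaps. Each gap is the proper part of
the product of chains given by the nonzero coordinate differences. Hence for $q\ge k$ the links are
exactly the joins of $m+1$ complexes $K_\sigma$ of total size $k$, one-part $\sigma$ being allowed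
(`linkTypes_eq`).

A one-part $\sigma=(a)$ contributes $a-1$ cone points. The type of a join amounts to the multiset of
its $\sigma$ with at least two parts, its core, together with the number of cone points
(`joinType_eq_iff_core`). Indeed the incomparability graph of $K_\sigma$ is connected for at least
two parts, so the members are recovered as components of the non-adjacency graph. And $\sigma$ is
recovered from $K_\sigma$: after restoring minimum and maximum, the number of multichains of length
$t$ depends only on comparability and equals $\prod_a\binom{a+t}{t}$; consecutive quotients are
$\prod_a (t+1+a)/(t+1)$, whose roots show the parts.

Give $\sigma$ the weight $|\sigma|-1$. For $k=2m+2$ the weights of the $m+1$ members sum to $m+1$,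
so the core has weight at most $m+1$ and fixes the number of cone points; every such core occurs
(`exists_family_core_eq`). Cores of weight $s+1$ are counted by $Q_s$, because a join of dimension
$s$ has total weight $s+1$; weight $0$ gives the additional $1$. Finally there are $p_{n+1}-1$
partitions of weight $n$ with at least two parts, which gives the product formula. -/

namespace EdgewiseSubdivision

/-! ### Flag complexes -/

/-- `K` is the flag complex of the relation `r`, whose elements are embedded by `g` as the vertices
of `K`. -/
structure IsFlagOf {V α : Type*} (K : PreAbstractSimplicialComplex V) (r : α → α → Prop)
    (g : α → V) : Prop where
  refl : ∀ a, r a a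
  symm : ∀ a b, r a b → r b a
  inj : Function.Injective g
  mem_faces : ∀ s : Finset V, s ∈ K.faces ↔
    s.Nonempty ∧ (∀ x ∈ s, x ∈ Set.range g) ∧ ∀ a b, g a ∈ s → g b ∈ s → r a b

namespace IsFlagOf

variable {V W α β : Type*} {K : PreAbstractSimplicialComplex V}
  {L : PreAbstractSimplicialComplex W} {r : α → α → Prop} {r' : β → β → Prop}
  {g : α → V} {g' : β → W}

theorem vertexSet_eq (h : IsFlagOf K r g) : vertexSet K = Set.range g := by
  ext x
  simp only [vertexSet, Set.mem_ofPred_eq, h.mem_faces, Finset.mem_singleton, forall_eq,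
    Finset.singleton_nonempty, true_and]
  refine ⟨fun hx => hx.1, ?_⟩
  rintro ⟨a, rfl⟩
  refine ⟨⟨a, rfl⟩, fun b c hb hc => ?_⟩
  rw [h.inj hb, h.inj hc]
  exact h.refl a

/-- The vertices of a flag complex are the elements of the relation. -/
noncomputable def vertexEquiv (h : IsFlagOf K r g) : α ≃ vertexSet K :=
  (Equiv.ofInjective g h.inj).trans (Equiv.setCongr h.vertexSet_eq.symm)

theorem coe_vertexEquiv (h : IsFlagOf K r g) (a : α) : (h.vertexEquiv a : V) = g a := rfl

theorem map_mem_faces (h : IsFlagOf K r g) (s : Finset (vertexSet K)) :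
    s.map (Function.Embedding.subtype _) ∈ K.faces ↔
      s.Nonempty ∧ ∀ a b, h.vertexEquiv a ∈ s → h.vertexEquiv b ∈ s → r a b := by
  have key : ∀ a, g a ∈ s.map (Function.Embedding.subtype _) ↔ h.vertexEquiv a ∈ s := by
    intro a
    rw [← h.coe_vertexEquiv a]
    simp
  rw [h.mem_faces]
  simp only [key, Finset.map_nonempty]
  refine and_congr_right fun _ => and_iff_right ?_
  intro x hx
  obtain ⟨y, -, rfl⟩ := Finset.mem_map.1 hx
  rw [← h.vertexSet_eq]
  exact y.2

theorem rel_iff [DecidableEq (vertexSet K)] (h : IsFlagOf K r g) (a b : α) :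
    r a b ↔ ({h.vertexEquiv a, h.vertexEquiv b} : Finset (vertexSet K)).map
      (Function.Embedding.subtype _) ∈ K.faces := by
  rw [h.map_mem_faces]
  simp only [Finset.insert_nonempty, true_and, Finset.mem_insert, Finset.mem_singleton,
    h.vertexEquiv.apply_eq_iff_eq]
  constructor
  · rintro h1 c d (rfl | rfl) (rfl | rfl)
    exacts [h.refl _, h1, h.symm _ _ h1, h.refl _]
  · intro h1
    exact h1 _ _ (Or.inl rfl) (Or.inr rfl)

/-- A flag complex carries the same information as its graph: edges are the faces with at most two
vertices, and the other faces are the cliques. This reduces combinatorial equivalence to isomorphism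
of relations. -/
theorem combEquiv_iff (h : IsFlagOf K r g) (h' : IsFlagOf L r' g') :
    CombEquiv K L ↔ ∃ e : α ≃ β, ∀ a b, r a b ↔ r' (e a) (e b) := by
  classical
  constructor
  · rintro ⟨f, hf⟩
    refine ⟨(h.vertexEquiv.trans f).trans h'.vertexEquiv.symm, fun a b => ?_⟩
    rw [h.rel_iff, hf, h'.rel_iff]
    simp
  · rintro ⟨e, he⟩
    refine ⟨(h.vertexEquiv.symm.trans e).trans h'.vertexEquiv, fun s => ?_⟩
    rw [h.map_mem_faces, h'.map_mem_faces, Finset.map_nonempty]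
    refine and_congr_right fun _ => ?_
    have key : ∀ a, h'.vertexEquiv (e a) ∈
        s.map ((h.vertexEquiv.symm.trans e).trans h'.vertexEquiv).toEmbedding ↔
        h.vertexEquiv a ∈ s := by
      intro a
      rw [Finset.mem_map_equiv]
      simp
    constructor
    · intro H a b ha hb
      obtain ⟨a, rfl⟩ := e.surjective a
      obtain ⟨b, rfl⟩ := e.surjective b
      rw [key] at ha hb
      exact (he a b).1 (H a b ha hb)
    · intro H a b ha hb
      exact (he a b).2 (H _ _ ((key a).2 ha) ((key b).2 hb))

end IsFlagOf

/-! ### Comparability and joins of order complexes -/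

/-- Comparability of two elements. -/
def Comp {P : Type*} [LE P] (a b : P) : Prop := a ≤ b ∨ b ≤ a

theorem Comp.refl {P : Type*} [Preorder P] (a : P) : Comp a a := Or.inl le_rfl

theorem Comp.symm {P : Type*} [LE P] {a b : P} (h : Comp a b) : Comp b a := Or.symm h

/-- The adjacency relation of a join: elements of different members are always adjacent, elements
of the same member if they are comparable. -/
def JoinRel {J : Type*} {P : J → Type*} [∀ j, LE (P j)] (u v : Σ j, P j) : Prop :=
  ∀ (j : J) (a b : P j), u = ⟨j, a⟩ → v = ⟨j, b⟩ → Comp a b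

theorem joinRel_mk_iff {J : Type*} {P : J → Type*} [∀ j, LE (P j)] {j : J} {a b : P j} :
    JoinRel (⟨j, a⟩ : Σ j, P j) ⟨j, b⟩ ↔ Comp a b := by
  refine ⟨fun h => h j a b rfl rfl, ?_⟩
  rintro h i a' b' ha hb
  obtain ⟨rfl, ha⟩ := Sigma.mk.inj_iff.1 ha
  rw [← eq_of_heq ha, ← eq_of_heq (Sigma.mk.inj_iff.1 hb).2]
  exact h

theorem joinRel_of_ne {J : Type*} {P : J → Type*} [∀ j, LE (P j)] {u v : Σ j, P j}
    (h : u.1 ≠ v.1) : JoinRel u v := by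
  rintro j a b rfl rfl
  exact absurd rfl h

theorem isFlagOf_join {J : Type*} (P : J → Type*) [∀ j, PartialOrder (P j)] :
    IsFlagOf (join fun j => orderComplex (P j)) (JoinRel (P := P)) id where
  refl := by
    rintro ⟨j, a⟩
    exact joinRel_mk_iff.2 (Comp.refl a)
  symm := fun u v h j a b hu hv => (h j b a hv hu).symm
  inj := Function.injective_id
  mem_faces := by
    intro s
    refine and_congr_right fun _ => ?_
    simp only [Set.range_id, Set.mem_univ, implies_true, true_and, id]
    constructor
    · rintro h u v hu hv j a b rfl rfl
      have ha : a ∈ s.preimage (Sigma.mk j) sigma_mk_injective.injOn := Finset.mem_preimage.2 hu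
      have hb : b ∈ s.preimage (Sigma.mk j) sigma_mk_injective.injOn := Finset.mem_preimage.2 hv
      rcases h j with h | h
      · rw [h] at ha
        simp at ha
      · exact h.2.total ha hb
    · intro h j
      rcases Finset.eq_empty_or_nonempty
        (s.preimage (Sigma.mk j) sigma_mk_injective.injOn) with h0 | h0
      · exact Or.inl h0
      · refine Or.inr ⟨h0, fun a ha b hb _ => ?_⟩
        exact joinRel_mk_iff.1 (h _ _ (Finset.mem_preimage.1 ha) (Finset.mem_preimage.1 hb))

/-- The product of chains of lengths `d i`. -/
abbrev Chains {ι : Type*} (d : ι → ℕ) : Type _ := ∀ i, Fin (d i + 1)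

/-- The proper part of the product of chains whose lengths are the elements of a multiset. -/
abbrev ProperPart (s : Multiset ℕ) : Type :=
  {x : Chains (fun i : s.ToType => i.1) // x ≠ ⊥ ∧ x ≠ ⊤}

/-- The combinatorial type of the join of the complexes `K_σ` for a family of multisets `σ`. -/
def joinType {J : Type} (s : J → Multiset ℕ) : CombType :=
  combType (join fun j => orderComplex (ProperPart (s j)))

theorem joinType_eq_iff {J J' : Type} (s : J → Multiset ℕ) (s' : J' → Multiset ℕ) :
    joinType s = joinType s' ↔
      ∃ e : (Σ j, ProperPart (s j)) ≃ (Σ j, ProperPart (s' j)),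
        ∀ u v, JoinRel u v ↔ JoinRel (e u) (e v) := by
  rw [← (isFlagOf_join fun j => ProperPart (s j)).combEquiv_iff
    (isFlagOf_join fun j => ProperPart (s' j))]
  exact Quotient.eq (r := complexSetoid)

/-! ### Counting multichains -/

/-- Equal multisets of values mean fibres of equal size, and bijections between the fibres glue. -/
theorem exists_equiv_of_map_univ_eq {α β γ : Type*} [Fintype α] [Fintype β] (f : α → γ)
    (g : β → γ) (h : Finset.univ.val.map f = Finset.univ.val.map g) :
    ∃ e : α ≃ β, ∀ a, g (e a) = f a := by
  classical
  have hc : ∀ c, Nonempty ({a // f a = c} ≃ {b // g b = c}) := by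
    intro c
    refine Fintype.card_eq.1 ?_
    have := congrArg (Multiset.count c) h
    rw [Multiset.count_map, Multiset.count_map] at this
    rw [Fintype.card_subtype, Fintype.card_subtype, Finset.card_def, Finset.card_def,
      Finset.filter_val, Finset.filter_val]
    simpa only [eq_comm] using this
  exact ⟨Equiv.ofFiberEquiv fun c => (hc c).some, Equiv.ofFiberEquiv_map _⟩

theorem map_univ_eq_of_equiv {α β γ : Type*} [Fintype α] [Fintype β] (f : α → γ)
    (g : β → γ) (e : α ≃ β) (h : ∀ a, g (e a) = f a) :
    Finset.univ.val.map f = Finset.univ.val.map g := by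
  rw [← Finset.map_univ_equiv e, Finset.map_val, Multiset.map_map]
  exact Multiset.map_congr rfl fun a _ => (h a).symm

theorem monotone_eq_of_map_univ_eq {P : Type*} [PartialOrder P] {t : ℕ} {f g : Fin t → P}
    (hf : Monotone f) (hg : Monotone g) (h : Finset.univ.val.map f = Finset.univ.val.map g) :
    f = g := by
  refine List.ofFn_injective (List.Perm.eq_of_pairwise (le := (· ≤ ·)) ?_ ?_ ?_ ?_)
  · intro a b _ _ hab hba
    exact le_antisymm hab hba
  · exact List.pairwise_ofFn.2 fun i j hij => hf hij.le
  · exact List.pairwise_ofFn.2 fun i j hij => hg hij.le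
  · rw [← Multiset.coe_eq_coe]
    simpa [List.ofFn_eq_map] using h

/-- Sort by a linear extension of the order: on pairwise comparable elements the extension agrees
with the order itself. -/
theorem exists_monotone_of_comp {P : Type*} [PartialOrder P] {t : ℕ} (m : Multiset P)
    (hm : m.card = t) (h : ∀ a ∈ m, ∀ b ∈ m, Comp a b) :
    ∃ f : Fin t → P, Monotone f ∧ Finset.univ.val.map f = m := by
  classical
  subst hm
  obtain ⟨r, hr, hle⟩ := extend_partialOrder ((· ≤ ·) : P → P → Prop)
  have hl : ((m.sort r : List P) : Multiset P) = m := Multiset.sort_eq m r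
  have hlen : (m.sort r).length = m.card := Multiset.length_sort r
  have hpw : (m.sort r).Pairwise (· ≤ ·) := by
    refine (Multiset.pairwise_sort m r).imp_of_mem fun {a b} ha hb hab => ?_
    rcases h a ((Multiset.mem_sort r).1 ha) b ((Multiset.mem_sort r).1 hb) with h1 | h1
    · exact h1
    · exact (antisymm (r := r) hab (hle _ _ h1)).le
  refine ⟨fun i => (m.sort r).get (i.cast hlen.symm), ?_, ?_⟩
  · intro i j hij
    rcases hij.eq_or_lt with rfl | hij
    · exact le_rfl
    · exact List.pairwise_iff_get.1 hpw _ _ hij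
  · conv_rhs => rw [← hl]
    rw [Fin.univ_val_map, List.ofFn_congr hlen.symm]
    exact congrArg _ (List.ofFn_get _)

/-- The number of multichains of length `t`. -/
noncomputable def multichains (P : Type*) [PartialOrder P] (t : ℕ) : ℕ :=
  Nat.card {f : Fin t → P // Monotone f}

/-- The right side mentions only comparability, so the count is invariant under bijections that
preserve comparability but perhaps not the order. -/
theorem multichains_eq_card_sym (P : Type*) [PartialOrder P] (t : ℕ) :
    multichains P t = Nat.card {m : Sym P t // ∀ a ∈ m, ∀ b ∈ m, Comp a b} := by
  refine Nat.card_congr (Equiv.ofBijective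
    (fun f => ⟨⟨Finset.univ.val.map f.1, by simp⟩, ?_⟩) ⟨?_, ?_⟩)
  · intro a ha b hb
    obtain ⟨i, -, rfl⟩ := Multiset.mem_map.1 ((Sym.mem_mk _ _ _).1 ha)
    obtain ⟨j, -, rfl⟩ := Multiset.mem_map.1 ((Sym.mem_mk _ _ _).1 hb)
    exact (le_total i j).imp (fun h => f.2 h) fun h => f.2 h
  · intro f g h
    have h1 : Finset.univ.val.map f.1 = Finset.univ.val.map g.1 :=
      congrArg (fun m => (m.1 : Multiset P)) h
    exact Subtype.ext (monotone_eq_of_map_univ_eq f.2 g.2 h1)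
  · rintro ⟨⟨m, hm⟩, h⟩
    obtain ⟨f, hf, hfm⟩ := exists_monotone_of_comp m hm h
    exact ⟨⟨f, hf⟩, Subtype.ext (Subtype.ext hfm)⟩

theorem multichains_congr {P R : Type*} [PartialOrder P] [PartialOrder R] (e : P ≃ R)
    (h : ∀ a b, Comp a b ↔ Comp (e a) (e b)) (t : ℕ) : multichains P t = multichains R t := by
  rw [multichains_eq_card_sym, multichains_eq_card_sym]
  refine Nat.card_congr ((Sym.equivCongr e).subtypeEquiv fun m => ?_)
  simp [Sym.equivCongr, h]

theorem multichains_of_linearOrder (P : Type*) [LinearOrder P] [Fintype P] (t : ℕ) :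
    multichains P t = (Fintype.card P).multichoose t := by
  classical
  rw [multichains_eq_card_sym, ← Sym.card_sym_eq_multichoose, ← Nat.card_eq_fintype_card]
  exact Nat.card_congr (Equiv.subtypeUnivEquiv fun m a _ b _ => le_total a b)

theorem multichains_chains {ι : Type*} [Fintype ι] (d : ι → ℕ) (t : ℕ) :
    multichains (Chains d) t = ∏ i, (d i + 1).multichoose t := by
  have : ∀ i, (d i + 1).multichoose t = multichains (Fin (d i + 1)) t := fun i => by
    rw [multichains_of_linearOrder, Fintype.card_fin]
  simp only [this]
  unfold multichains
  rw [← Nat.card_pi]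
  refine Nat.card_congr ⟨fun f i => ⟨fun a => f.1 a i, fun a b h => f.2 h i⟩,
    fun f => ⟨fun a i => (f i).1 a, fun a b h i => (f i).2 h⟩, fun f => rfl, fun f => rfl⟩

/-- Passing from `t` to `t + 1` multiplies the number of multichains in a chain of length `a` by
$(a+t+1)/(t+1)$; the identity is cleared of denominators. -/
theorem multichoose_add_one_mul (a t : ℕ) :
    (a + 1).multichoose (t + 1) * (t + 1) = (a + 1).multichoose t * (a + (t + 1)) := by
  rw [Nat.multichoose_eq, Nat.multichoose_eq,
    show a + 1 + (t + 1) - 1 = (a + t) + 1 by omega, show a + 1 + t - 1 = a + t by omega,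
    ← Nat.add_one_mul_choose_eq]
  ring

theorem prod_multichoose_mul_pow (s : Multiset ℕ) (t : ℕ) :
    (s.map fun a => (a + 1).multichoose (t + 1)).prod * (t + 1) ^ s.card =
      (s.map fun a => (a + 1).multichoose t).prod * (s.map fun a => a + (t + 1)).prod := by
  induction s using Multiset.induction with
  | empty => simp
  | cons a s ih =>
    simp only [Multiset.map_cons, Multiset.prod_cons, Multiset.card_cons, pow_succ]
    calc _ = (a + 1).multichoose (t + 1) * (t + 1) *
          ((s.map fun a => (a + 1).multichoose (t + 1)).prod * (t + 1) ^ s.card) := by ring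
      _ = _ := by rw [ih, multichoose_add_one_mul]; ring

theorem prod_multichoose_pos (s : Multiset ℕ) (t : ℕ) :
    0 < (s.map fun a => (a + 1).multichoose t).prod := by
  refine Multiset.prod_pos fun x hx => ?_
  obtain ⟨a, -, rfl⟩ := Multiset.mem_map.1 hx
  rw [Nat.multichoose_eq]
  exact Nat.choose_pos (by omega)

/-- The product of the numbers `multichoose (a + 1) t` for all `t` determines the positive elements
of a multiset. -/
theorem eq_of_prod_multichoose_eq {s s' : Multiset ℕ} (hs : 0 ∉ s) (hs' : 0 ∉ s')
    (h : ∀ t, (s.map fun a => (a + 1).multichoose t).prod =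
      (s'.map fun a => (a + 1).multichoose t).prod) : s = s' := by
  -- Compare the growth from `t` to `t + 1` on both sides. The cardinalities are not yet known to
  -- agree, so the denominators $(t+1)^{|s|}$ and $(t+1)^{|s'|}$ are cross-multiplied.
  have key : ∀ t : ℕ, (s.map fun a => a + (t + 1)).prod * (t + 1) ^ s'.card =
      (s'.map fun a => a + (t + 1)).prod * (t + 1) ^ s.card := by
    intro t
    have h1 := prod_multichoose_mul_pow s t
    have h2 := prod_multichoose_mul_pow s' t
    rw [h (t + 1), h t] at h1
    refine Nat.eq_of_mul_eq_mul_left (prod_multichoose_pos s' t) ?_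
    rw [← mul_assoc, ← h1, ← mul_assoc, ← h2]
    ring
  -- The two sides of `key` are values at $t+1$ of monic polynomials with these roots: the negated
  -- elements, and zeros from the cross-multiplied power. All elements being positive, the zeros do
  -- not interfere.
  let z : Multiset ℕ → ℕ → Multiset ℤ := fun s k =>
    s.map (fun a : ℕ => -(a : ℤ)) + Multiset.replicate k 0
  let p : Multiset ℕ → ℕ → Polynomial ℤ := fun s k =>
    ((z s k).map fun a => Polynomial.X - Polynomial.C a).prod
  have hev : ∀ s k (t : ℕ), (p s k).eval ((t : ℤ) + 1) =
      (((s.map fun a => a + (t + 1)).prod * (t + 1) ^ k : ℕ) : ℤ) := by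
    intro s k t
    simp only [p, z, Multiset.map_add, Multiset.map_map, Polynomial.eval_mul,
      Multiset.prod_add, Multiset.map_replicate, Multiset.prod_replicate]
    push_cast
    congr 1
    · rw [Polynomial.eval_multiset_prod, Multiset.map_map, Multiset.map_map]
      congr 1
      refine Multiset.map_congr rfl fun a _ => ?_
      simp
      ring
    · simp
  have hp : p s s'.card = p s' s.card := by
    refine Polynomial.eq_of_infinite_eval_eq _ _ (Set.Infinite.mono ?_
      (Set.infinite_range_of_injective (f := fun t : ℕ => (t : ℤ) + 1) ?_))
    · rintro _ ⟨t, rfl⟩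
      change (p s _).eval ((t : ℤ) + 1) = (p s' _).eval ((t : ℤ) + 1)
      rw [hev, hev, key]
    · intro a b hab
      simpa using hab
  have hz : z s s'.card = z s' s.card := by
    have := congrArg Polynomial.roots hp
    simpa only [p, Polynomial.roots_multiset_prod_X_sub_C] using this
  ext a
  rcases Nat.eq_zero_or_pos a with rfl | ha
  · rw [Multiset.count_eq_zero_of_notMem hs, Multiset.count_eq_zero_of_notMem hs']
  · have hinj : Function.Injective fun a : ℕ => -(a : ℤ) := fun a b hab => by simpa using hab
    have := congrArg (Multiset.count (-(a : ℤ))) hz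
    simp only [z, Multiset.count_add, Multiset.count_replicate] at this
    rw [Multiset.count_map_eq_count' _ _ hinj, Multiset.count_map_eq_count' _ _ hinj,
      if_neg (by omega), if_neg (by omega)] at this
    simpa using this

theorem multichains_chains_toType (s : Multiset ℕ) (t : ℕ) :
    multichains (Chains fun i : s.ToType => i.1) t =
      (s.map fun a => (a + 1).multichoose t).prod := by
  rw [multichains_chains]
  conv_rhs => rw [← Multiset.map_univ_coe s, Multiset.map_map]
  rfl

/-! ### Gluing equivalences along elements comparable to everything -/

/-- Elements related to everything impose no condition, so any bijection between them extends an
isomorphism of the rest. -/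
theorem exists_equiv_of_cone {α β : Type*} {r : α → α → Prop} {r' : β → β → Prop}
    (p : α → Prop) (q : β → Prop) (e : {a // p a} ≃ {b // q b})
    (f : {a // ¬ p a} ≃ {b // ¬ q b}) (he : ∀ a b, r a.1 b.1 ↔ r' (e a).1 (e b).1)
    (hp : ∀ a b, ¬ p a → r a b ∧ r b a) (hq : ∀ a b, ¬ q a → r' a b ∧ r' b a) :
    ∃ g : α ≃ β, ∀ a b, r a b ↔ r' (g a) (g b) := by
  classical
  refine ⟨(Equiv.sumCompl p).symm.trans ((Equiv.sumCongr e f).trans (Equiv.sumCompl q)), ?_⟩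
  intro a b
  obtain ⟨a, rfl⟩ := (Equiv.sumCompl p).surjective a
  obtain ⟨b, rfl⟩ := (Equiv.sumCompl p).surjective b
  simp only [Equiv.trans_apply, Equiv.symm_apply_apply]
  rcases a with a | a
  · rcases b with b | b
    · exact he a b
    · exact iff_of_true (hp _ _ b.2).2 (hq _ _ (f b).2).2
  · exact iff_of_true (hp _ _ a.2).1 (hq _ _ (f a).2).1

theorem card_not_proper (P : Type*) [PartialOrder P] [BoundedOrder P] [Nontrivial P] :
    Nat.card {x : P // ¬ (x ≠ ⊥ ∧ x ≠ ⊤)} = 2 := by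
  have : {x : P | ¬ (x ≠ ⊥ ∧ x ≠ ⊤)} = {⊥, ⊤} := by
    ext x
    simp only [Set.mem_ofPred_eq, Set.mem_insert_iff, Set.mem_singleton_iff]
    tauto
  exact (congrArg Set.ncard this).trans (Set.ncard_pair bot_ne_top)

theorem comp_of_not_proper {P : Type*} [PartialOrder P] [BoundedOrder P] (a b : P)
    (h : ¬ (a ≠ ⊥ ∧ a ≠ ⊤)) : Comp a b ∧ Comp b a := by
  rcases eq_or_ne a ⊥ with rfl | h1
  · exact ⟨Or.inl bot_le, Or.inr bot_le⟩
  · obtain rfl : a = ⊤ := by tauto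
    exact ⟨Or.inr le_top, Or.inl le_top⟩

/-- The two removed elements are comparable to everything and can be restored. Their matching is
arbitrary; minimum need not go to minimum. -/
theorem exists_equiv_of_proper {P R : Type*} [PartialOrder P] [BoundedOrder P] [PartialOrder R]
    [BoundedOrder R] [Nontrivial P] [Nontrivial R]
    (e : {x : P // x ≠ ⊥ ∧ x ≠ ⊤} ≃ {x : R // x ≠ ⊥ ∧ x ≠ ⊤})
    (h : ∀ a b, Comp a b ↔ Comp (e a) (e b)) :
    ∃ g : P ≃ R, ∀ a b, Comp a b ↔ Comp (g a) (g b) := by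
  have h1 := card_not_proper P
  have h2 := card_not_proper R
  have := Nat.finite_of_card_ne_zero (h1.trans_ne two_ne_zero)
  have := Nat.finite_of_card_ne_zero (h2.trans_ne two_ne_zero)
  exact exists_equiv_of_cone _ _ e (Finite.card_eq.1 (h1.trans h2.symm)).some h
    comp_of_not_proper comp_of_not_proper

theorem nontrivial_chains {ι : Type*} {d : ι → ℕ} (i : ι) (hi : d i ≠ 0) :
    Nontrivial (Chains d) := by
  have : Nontrivial (Fin (d i + 1)) := Fin.nontrivial_iff_two_le.2 (by omega)
  exact Pi.nontrivial_at i

theorem eq_of_properPart_equiv {s s' : Multiset ℕ} (hs : 0 ∉ s) (hs' : 0 ∉ s') (h0 : s ≠ 0)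
    (h0' : s' ≠ 0) (e : ProperPart s ≃ ProperPart s')
    (h : ∀ a b, Comp a b ↔ Comp (e a) (e b)) : s = s' := by
  have hn : ∀ {s : Multiset ℕ}, 0 ∉ s → s ≠ 0 → Nontrivial (Chains fun i : s.ToType => i.1) := by
    intro s hs h0
    obtain ⟨a, ha⟩ := Multiset.exists_mem_of_ne_zero h0
    refine nontrivial_chains (⟨a, ⟨0, Multiset.count_pos.2 ha⟩⟩ : s.ToType) ?_
    rintro rfl
    exact hs ha
  have := hn hs h0
  have := hn hs' h0'
  obtain ⟨g, hg⟩ := exists_equiv_of_proper e h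
  refine eq_of_prod_multichoose_eq hs hs' fun t => ?_
  rw [← multichains_chains_toType, ← multichains_chains_toType]
  exact multichains_congr g hg t

/-! ### Connectedness of the incomparability graph -/

theorem bot_ne_top_of_ne_zero {ι : Type*} {d : ι → ℕ} {i : ι} (h : d i ≠ 0) :
    (⊥ : Fin (d i + 1)) ≠ ⊤ := by
  have : Nontrivial (Fin (d i + 1)) := Fin.nontrivial_iff_two_le.2 (by omega)
  exact bot_ne_top

section Columns

variable {ι : Type*} [DecidableEq ι] {d : ι → ℕ}

/-- The element of a product of chains that is maximal in one coordinate and minimal in the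
others. -/
noncomputable def column (d : ι → ℕ) (j : ι) : Chains d := fun i => if i = j then ⊤ else ⊥

theorem column_self (j : ι) : column d j j = ⊤ := if_pos rfl

theorem column_of_ne {i j : ι} (h : i ≠ j) : column d j i = ⊥ := if_neg h

theorem column_proper [Nontrivial ι] (hd : ∀ i, d i ≠ 0) (j : ι) :
    column d j ≠ ⊥ ∧ column d j ≠ ⊤ := by
  obtain ⟨i, hi⟩ := exists_ne j
  refine ⟨fun h => ?_, fun h => ?_⟩
  · have := congrFun h j
    rw [column_self] at this
    exact bot_ne_top_of_ne_zero (hd j) this.symm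
  · have := congrFun h i
    rw [column_of_ne hi] at this
    exact bot_ne_top_of_ne_zero (hd i) this

theorem not_comp_column {x : Chains d} {i j : ι} (hij : i ≠ j) (hi : x i ≠ ⊥) (hj : x j ≠ ⊤) :
    ¬ Comp x (column d j) := by
  rintro (h | h)
  · exact hi (le_bot_iff.1 ((h i).trans_eq (column_of_ne hij)))
  · exact hj (top_le_iff.1 ((column_self j).symm.trans_le (h j)))

/-- If `x` vanishes at some coordinate, the column there works, since `x` is nonzero elsewhere. If
`x` vanishes nowhere, take the column at a coordinate where `x` is not maximal. -/
theorem exists_not_comp_column [Nontrivial ι] (hd : ∀ i, d i ≠ 0) {x : Chains d}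
    (h : x ≠ ⊥ ∧ x ≠ ⊤) : ∃ j, ¬ Comp x (column d j) := by
  by_cases h0 : ∃ i, x i = ⊥
  · obtain ⟨j, hj⟩ := h0
    obtain ⟨i, hi⟩ := Function.ne_iff.1 h.1
    refine ⟨j, not_comp_column (i := i) ?_ hi ?_⟩
    · rintro rfl
      exact hi hj
    · rw [hj]
      exact bot_ne_top_of_ne_zero (hd j)
  · push Not at h0
    obtain ⟨j, hj⟩ := Function.ne_iff.1 h.2
    obtain ⟨i, hi⟩ := exists_ne j
    exact ⟨j, not_comp_column hi (h0 i) hj⟩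

/-- The incomparability graph of the proper part of a product of at least two chains is
connected. -/
theorem eq_of_not_comp_imp_eq [Nontrivial ι] (hd : ∀ i, d i ≠ 0) {γ : Type*}
    (c : {x : Chains d // x ≠ ⊥ ∧ x ≠ ⊤} → γ) (hc : ∀ x y, ¬ Comp x y → c x = c y)
    (x y : {x : Chains d // x ≠ ⊥ ∧ x ≠ ⊤}) : c x = c y := by
  -- Distinct columns are incomparable, and every element is incomparable to some column, so paths
  -- through columns connect everything.
  have h1 : ∀ i j, c ⟨column d i, column_proper hd i⟩ = c ⟨column d j, column_proper hd j⟩ := by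
    intro i j
    rcases eq_or_ne i j with rfl | hij
    · rfl
    · refine hc _ _ (not_comp_column (i := i) hij ?_ ?_)
      · change column d i i ≠ ⊥
        rw [column_self]
        exact (bot_ne_top_of_ne_zero (hd i)).symm
      · change column d i j ≠ ⊤
        rw [column_of_ne hij.symm]
        exact bot_ne_top_of_ne_zero (hd j)
  obtain ⟨i, hi⟩ := exists_not_comp_column hd x.2
  obtain ⟨j, hj⟩ := exists_not_comp_column hd y.2
  exact (hc x ⟨_, column_proper hd i⟩ hi).trans
    ((h1 i j).trans (hc y ⟨_, column_proper hd j⟩ hj).symm)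

end Columns

theorem ne_zero_of_toType {s : Multiset ℕ} (hs : 0 ∉ s) (i : s.ToType) : i.1 ≠ 0 := by
  intro h
  exact hs (h ▸ Multiset.coe_mem)

theorem nontrivial_toType {s : Multiset ℕ} (h : 2 ≤ s.card) : Nontrivial s.ToType := by
  rw [← Fintype.one_lt_card_iff_nontrivial, Multiset.card_coe]
  exact h

theorem exists_not_comp {s : Multiset ℕ} (hs : 0 ∉ s) (h : 2 ≤ s.card) (x : ProperPart s) :
    ∃ y : ProperPart s, ¬ Comp x y := by
  classical
  have := nontrivial_toType h
  obtain ⟨j, hj⟩ := exists_not_comp_column (ne_zero_of_toType hs) x.2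
  exact ⟨⟨_, column_proper (ne_zero_of_toType hs) j⟩, hj⟩

theorem nonempty_properPart {s : Multiset ℕ} (hs : 0 ∉ s) (h : 2 ≤ s.card) :
    Nonempty (ProperPart s) := by
  classical
  have := nontrivial_toType h
  obtain ⟨j, -⟩ := exists_pair_ne s.ToType
  exact ⟨⟨_, column_proper (ne_zero_of_toType hs) j⟩⟩

theorem properPart_eq_of_not_comp_imp_eq {s : Multiset ℕ} (hs : 0 ∉ s) (h : 2 ≤ s.card)
    {γ : Type*} (c : ProperPart s → γ) (hc : ∀ x y, ¬ Comp x y → c x = c y)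
    (x y : ProperPart s) : c x = c y := by
  classical
  have := nontrivial_toType h
  exact eq_of_not_comp_imp_eq (ne_zero_of_toType hs) c hc x y

theorem comp_of_card_lt_two {s : Multiset ℕ} (h : s.card < 2) (x y : ProperPart s) :
    Comp x y := by
  have : Subsingleton s.ToType := by
    rw [← Fintype.card_le_one_iff_subsingleton, Multiset.card_coe]
    omega
  by_cases h0 : ∃ i, x.1 i ≤ y.1 i
  · obtain ⟨i, hi⟩ := h0
    exact Or.inl fun j => Subsingleton.elim i j ▸ hi
  · push Not at h0
    exact Or.inr fun j => (h0 j).le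

/-- The number of vertices of `K_σ` if `σ` has one part. -/
theorem card_properPart_singleton {a : ℕ} (ha : a ≠ 0) :
    Nat.card (ProperPart {a}) = a - 1 := by
  classical
  have hn : Nontrivial (Chains fun i : Multiset.ToType {a} => i.1) :=
    nontrivial_chains (⟨a, ⟨0, by simp⟩⟩ : Multiset.ToType {a}) ha
  have h1 : Nat.card (Chains fun i : Multiset.ToType {a} => i.1) = a + 1 := by
    rw [Nat.card_pi]
    simp only [Nat.card_fin]
    have := congrArg Multiset.prod (congrArg (Multiset.map (· + 1)) (Multiset.map_univ_coe {a}))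
    rw [Multiset.map_map] at this
    simpa using this
  have h2 := card_not_proper (Chains fun i : Multiset.ToType {a} => i.1)
  have h3 := Nat.card_congr (Equiv.sumCompl
    fun x : Chains (fun i : Multiset.ToType {a} => i.1) => x ≠ ⊥ ∧ x ≠ ⊤)
  rw [Nat.card_sum, h1, h2] at h3
  change Nat.card (ProperPart {a}) + _ = _ at h3
  omega

/-! ### Classification of the joins -/

/-- The members with at least two parts. -/
def core {J : Type*} [Fintype J] (s : J → Multiset ℕ) : Multiset (Multiset ℕ) :=
  (Finset.univ.val.map s).filter fun σ => 2 ≤ σ.card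

/-- The number of cone points. -/
def coneCount {J : Type*} [Fintype J] (s : J → Multiset ℕ) : ℕ :=
  ∑ j, if 2 ≤ (s j).card then 0 else (s j).sum - 1

section Classification

variable {J J' : Type} {s : J → Multiset ℕ} {s' : J' → Multiset ℕ}

/-- Being adjacent to everything is visible in the relation alone, so isomorphisms of joins separate
the members with at least two parts from the others. -/
theorem cone_iff (hs : ∀ j, 0 ∉ s j) (u : Σ j, ProperPart (s j)) :
    (∀ v, JoinRel u v) ↔ ¬ 2 ≤ (s u.1).card := by
  obtain ⟨j, x⟩ := u
  constructor
  · intro h h2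
    obtain ⟨y, hy⟩ := exists_not_comp (hs j) h2 x
    exact hy ((joinRel_mk_iff (P := fun j => ProperPart (s j))).1 (h ⟨j, y⟩))
  · rintro h v i a b hu rfl
    obtain ⟨rfl, -⟩ := Sigma.mk.inj_iff.1 hu
    exact comp_of_card_lt_two (not_le.1 h) a b

/-- An equivalence of joins maps the members with at least two parts to such members. -/
theorem exists_member_equiv (hs : ∀ j, 0 ∉ s j) (hs' : ∀ j, 0 ∉ s' j)
    (e : (Σ j, ProperPart (s j)) ≃ (Σ j, ProperPart (s' j)))
    (he : ∀ u v, JoinRel u v ↔ JoinRel (e u) (e v)) (j : J) (h : 2 ≤ (s j).card) :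
    ∃ j', 2 ≤ (s' j').card ∧ ∀ x, ∃ y, e ⟨j, x⟩ = ⟨j', y⟩ := by
  obtain ⟨x₀⟩ := nonempty_properPart (hs j) h
  refine ⟨(e ⟨j, x₀⟩).1, ?_, fun x => ?_⟩
  · by_contra hc
    refine (cone_iff hs ⟨j, x₀⟩).1 ?_ h
    intro v
    exact (he _ _).2 ((cone_iff hs' _).2 hc _)
  -- Incomparable elements have non-adjacent images, which lie in one member; connectedness of the
  -- incomparability graph then makes the target member constant.
  · have h1 : (e ⟨j, x⟩).1 = (e ⟨j, x₀⟩).1 := by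
      refine properPart_eq_of_not_comp_imp_eq (hs j) h (fun x => (e ⟨j, x⟩).1) ?_ x x₀
      intro x y hxy
      by_contra hne
      exact hxy ((joinRel_mk_iff (P := fun j => ProperPart (s j))).1
        ((he _ _).2 (joinRel_of_ne hne)))
    rw [← h1]
    exact ⟨_, rfl⟩

variable [Fintype J] [Fintype J']

theorem core_eq_map {J : Type} [Fintype J] (s : J → Multiset ℕ) :
    core s = Finset.univ.val.map fun j : {j // 2 ≤ (s j).card} => s j.1 := by
  classical
  rw [core, Multiset.filter_map]
  exact (Finset.univ_val_map_subtype_restrict s fun j => 2 ≤ (s j).card).symm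

theorem card_cone (hs : ∀ j, 0 ∉ s j) (h0 : ∀ j, s j ≠ 0) :
    Nat.card {u : Σ j, ProperPart (s j) // ¬ 2 ≤ (s u.1).card} = coneCount s := by
  classical
  let e : {u : Σ j, ProperPart (s j) // ¬ 2 ≤ (s u.1).card} ≃
      Σ j, {_x : ProperPart (s j) // ¬ 2 ≤ (s j).card} :=
    ⟨fun u => ⟨u.1.1, u.1.2, u.2⟩, fun u => ⟨⟨u.1, u.2.1⟩, u.2.2⟩, fun _ => rfl, fun _ => rfl⟩
  rw [Nat.card_congr e, Nat.card_sigma, coneCount]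
  refine Finset.sum_congr rfl fun j _ => ?_
  split_ifs with h
  · simp [h]
  · rw [Nat.card_congr (Equiv.subtypeUnivEquiv fun _ => h)]
    have hc : (s j).card = 1 := by
      have := Multiset.card_pos.2 (h0 j)
      omega
    obtain ⟨a, ha⟩ := Multiset.card_eq_one.1 hc
    have := hs j
    rw [ha] at this ⊢
    rw [card_properPart_singleton (by simpa [eq_comm] using this), Multiset.sum_singleton]

/-- The isomorphism and its inverse induce inverse bijections between the members with at least two
parts, and restrict to comparability isomorphisms of matched members, which therefore have the same
multiset. -/
theorem core_eq_of_equiv (hs : ∀ j, 0 ∉ s j) (hs' : ∀ j, 0 ∉ s' j)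
    (e : (Σ j, ProperPart (s j)) ≃ (Σ j, ProperPart (s' j)))
    (he : ∀ u v, JoinRel u v ↔ JoinRel (e u) (e v)) : core s = core s' := by
  have he' : ∀ u v, JoinRel u v ↔ JoinRel (e.symm u) (e.symm v) := by
    intro u v
    rw [he, e.apply_symm_apply, e.apply_symm_apply]
  choose f hf2 hf using exists_member_equiv hs hs' e he
  choose g hg2 hg using exists_member_equiv hs' hs e.symm he'
  have hgf : ∀ j h, g (f j h) (hf2 j h) = j := by
    intro j h
    obtain ⟨x⟩ := nonempty_properPart (hs j) h
    obtain ⟨y, hy⟩ := hf j h x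
    obtain ⟨z, hz⟩ := hg (f j h) (hf2 j h) y
    rw [← hy, e.symm_apply_apply] at hz
    exact (congrArg Sigma.fst hz).symm
  have hfg : ∀ j h, f (g j h) (hg2 j h) = j := by
    intro j h
    obtain ⟨x⟩ := nonempty_properPart (hs' j) h
    obtain ⟨y, hy⟩ := hg j h x
    obtain ⟨z, hz⟩ := hf (g j h) (hg2 j h) y
    rw [← hy, e.apply_symm_apply] at hz
    exact (congrArg Sigma.fst hz).symm
  have heq : ∀ j h, s' (f j h) = s j := by
    intro j h
    choose F hF using hf j h
    have hinj : Function.Injective F := by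
      intro x y hxy
      have : (⟨j, x⟩ : Σ j, ProperPart (s j)) = ⟨j, y⟩ := e.injective (by rw [hF, hF, hxy])
      simpa using this
    have hsurj : Function.Surjective F := by
      intro y
      have := hg (f j h) (hf2 j h) y
      rw [hgf] at this
      obtain ⟨z, hz⟩ := this
      refine ⟨z, ?_⟩
      have h1 := hF z
      rw [← hz, e.apply_symm_apply] at h1
      simpa [eq_comm] using h1
    refine (eq_of_properPart_equiv (hs j) (hs' _) ?_ ?_ (Equiv.ofBijective F ⟨hinj, hsurj⟩)
      fun x y => ?_).symm
    · rintro h0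
      simp [h0] at h
    · intro h0
      have := hf2 j h
      simp [h0] at this
    · rw [← joinRel_mk_iff (P := fun j => ProperPart (s j)), he, hF, hF]
      exact joinRel_mk_iff (P := fun j => ProperPart (s' j))
  rw [core_eq_map, core_eq_map]
  refine map_univ_eq_of_equiv _ _ ⟨fun j => ⟨f j.1 j.2, hf2 _ _⟩, fun j => ⟨g j.1 j.2, hg2 _ _⟩,
    fun j => Subtype.ext (hgf _ _), fun j => Subtype.ext (hfg _ _)⟩ fun j => heq _ _

theorem coneCount_eq_of_equiv (hs : ∀ j, 0 ∉ s j) (hs' : ∀ j, 0 ∉ s' j) (h0 : ∀ j, s j ≠ 0)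
    (h0' : ∀ j, s' j ≠ 0) (e : (Σ j, ProperPart (s j)) ≃ (Σ j, ProperPart (s' j)))
    (he : ∀ u v, JoinRel u v ↔ JoinRel (e u) (e v)) : coneCount s = coneCount s' := by
  rw [← card_cone hs h0, ← card_cone hs' h0']
  refine Nat.card_congr (e.subtypeEquiv fun u => ?_)
  rw [← cone_iff hs, ← cone_iff hs', ← e.forall_congr_right]
  exact forall_congr' fun v => he u v

theorem joinRel_sigmaCongr {J J' : Type*} {P : J → Type*} {P' : J' → Type*} [∀ j, LE (P j)]
    [∀ j, LE (P' j)] (e : J ≃ J') (F : ∀ j, P j ≃ P' (e j))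
    (hF : ∀ j a b, Comp a b ↔ Comp (F j a) (F j b)) (u v : Σ j, P j) :
    JoinRel u v ↔ JoinRel (e.sigmaCongr F u) (e.sigmaCongr F v) := by
  obtain ⟨i, a⟩ := u
  obtain ⟨j, b⟩ := v
  by_cases h : i = j
  · subst h
    rw [joinRel_mk_iff, hF]
    exact (joinRel_mk_iff (P := P')).symm
  · refine iff_of_true (joinRel_of_ne h) (joinRel_of_ne ?_)
    exact fun h' => h (e.injective h')

theorem joinRel_subtype {J : Type*} {P : J → Type*} [∀ j, LE (P j)] {p : J → Prop}
    (u v : Σ j : {j // p j}, P j.1) :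
    JoinRel u v ↔ JoinRel (⟨u.1.1, u.2⟩ : Σ j, P j) ⟨v.1.1, v.2⟩ := by
  obtain ⟨i, a⟩ := u
  obtain ⟨j, b⟩ := v
  by_cases h : i = j
  · subst h
    rw [joinRel_mk_iff, joinRel_mk_iff]
  · exact iff_of_true (joinRel_of_ne h) (joinRel_of_ne fun hij => h (Subtype.ext hij))

/-- The part of a sigma type over a subtype of the base. -/
def subtypeSigmaEquiv {J : Type*} (P : J → Type*) (p : J → Prop) :
    {u : Σ j, P j // p u.1} ≃ Σ j : {j // p j}, P j.1 :=
  ⟨fun u => ⟨⟨u.1.1, u.2⟩, u.1.2⟩, fun u => ⟨⟨u.1.1, u.2⟩, u.1.2⟩, fun _ => rfl, fun _ => rfl⟩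

/-- Equal cores give a matching of members by copies of the same poset; the cone points, equal in
number, are matched arbitrarily. -/
theorem exists_equiv_of_core_eq (hs : ∀ j, 0 ∉ s j) (hs' : ∀ j, 0 ∉ s' j) (h0 : ∀ j, s j ≠ 0)
    (h0' : ∀ j, s' j ≠ 0) (hcore : core s = core s') (hcone : coneCount s = coneCount s') :
    ∃ e : (Σ j, ProperPart (s j)) ≃ (Σ j, ProperPart (s' j)),
      ∀ u v, JoinRel u v ↔ JoinRel (e u) (e v) := by
  rw [core_eq_map, core_eq_map] at hcore
  obtain ⟨e, he⟩ := exists_equiv_of_map_univ_eq _ _ hcore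
  have hF : ∀ j : {j // 2 ≤ (s j).card}, ∃ F : ProperPart (s j.1) ≃ ProperPart (s' (e j).1),
      ∀ a b, Comp a b ↔ Comp (F a) (F b) := by
    intro j
    rw [he j]
    exact ⟨Equiv.refl _, fun a b => Iff.rfl⟩
  choose F hF using hF
  have h1 := card_cone hs h0
  have h2 := card_cone hs' h0'
  rw [← hcone, ← h1] at h2
  refine exists_equiv_of_cone (fun u : Σ j, ProperPart (s j) => 2 ≤ (s u.1).card)
    (fun u : Σ j, ProperPart (s' j) => 2 ≤ (s' u.1).card)
    ((subtypeSigmaEquiv _ fun j => 2 ≤ (s j).card).trans ((e.sigmaCongr F).trans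
      (subtypeSigmaEquiv _ fun j => 2 ≤ (s' j).card).symm)) (Finite.card_eq.1 h2.symm).some ?_ ?_ ?_
  · intro u v
    obtain ⟨u, rfl⟩ := (subtypeSigmaEquiv _ fun j => 2 ≤ (s j).card).symm.surjective u
    obtain ⟨v, rfl⟩ := (subtypeSigmaEquiv _ fun j => 2 ≤ (s j).card).symm.surjective v
    simp only [Equiv.trans_apply, Equiv.apply_symm_apply]
    refine (joinRel_subtype (P := fun j => ProperPart (s j)) (p := fun j => 2 ≤ (s j).card)
      u v).symm.trans ?_
    refine (joinRel_sigmaCongr (P' := fun j : {j // 2 ≤ (s' j).card} => ProperPart (s' j.1))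
      e F hF u v).trans ?_
    exact joinRel_subtype (P := fun j => ProperPart (s' j)) _ _
  · intro u v hu
    have h3 := (cone_iff hs u).2 hu v
    exact ⟨h3, fun j a b ha hb => (h3 j b a hb ha).symm⟩
  · intro u v hu
    have h3 := (cone_iff hs' u).2 hu v
    exact ⟨h3, fun j a b ha hb => (h3 j b a hb ha).symm⟩

theorem joinType_eq_iff_core (hs : ∀ j, 0 ∉ s j) (hs' : ∀ j, 0 ∉ s' j) (h0 : ∀ j, s j ≠ 0)
    (h0' : ∀ j, s' j ≠ 0) :
    joinType s = joinType s' ↔ core s = core s' ∧ coneCount s = coneCount s' := by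
  rw [joinType_eq_iff]
  constructor
  · rintro ⟨e, he⟩
    exact ⟨core_eq_of_equiv hs hs' e he, coneCount_eq_of_equiv hs hs' h0 h0' e he⟩
  · rintro ⟨h1, h2⟩
    exact exists_equiv_of_core_eq hs hs' h0 h0' h1 h2

end Classification

/-! ### The dimension of the joins -/

section Rank

variable {ι : Type*} [Fintype ι] {d : ι → ℕ}

/-- The rank of an element of a product of chains. -/
def rank (x : Chains d) : ℕ := ∑ i, (x i : ℕ)

theorem rank_strictMono : StrictMono (rank (d := d)) := by
  intro x y h
  obtain ⟨h1, i, hi⟩ := Pi.lt_def.1 h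
  exact Finset.sum_lt_sum (fun i _ => h1 i) ⟨i, Finset.mem_univ i, hi⟩

theorem rank_bot : rank (⊥ : Chains d) = 0 :=
  Finset.sum_eq_zero fun _ _ => rfl

theorem rank_top : rank (⊤ : Chains d) = ∑ i, d i := rfl

theorem rank_pos {x : Chains d} (h : x ≠ ⊥) : 0 < rank x :=
  rank_bot.symm.trans_lt (rank_strictMono (bot_lt_iff_ne_bot.2 h))

theorem rank_lt {x : Chains d} (h : x ≠ ⊤) : rank x < ∑ i, d i :=
  rank_strictMono (lt_top_iff_ne_top.2 h)

theorem exists_le_rank_eq_succ {x : Chains d} (h : x ≠ ⊤) : ∃ y, x ≤ y ∧ rank y = rank x + 1 := by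
  classical
  obtain ⟨i, hi⟩ := Function.ne_iff.1 h
  have hi' : (x i : ℕ) < d i := by
    have : x i < ⊤ := lt_top_iff_ne_top.2 hi
    exact this
  refine ⟨fun k => ⟨x k + if k = i then 1 else 0, ?_⟩, fun k => ?_, ?_⟩
  · split_ifs with hk
    · subst hk
      omega
    · exact (x k).2
  · exact Nat.le_add_right _ _
  · simp [rank, Finset.sum_add_distrib]

/-- Iterate a step that raises the rank by one until `⊤` is reached. -/
theorem exists_maximal_chain (d : ι → ℕ) :
    ∃ f : ℕ → Chains d, Monotone f ∧ ∀ a ≤ ∑ i, d i, rank (f a) = a := by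
  have : ∀ x : Chains d, ∃ y, x ≤ y ∧ (x ≠ ⊤ → rank y = rank x + 1) := by
    intro x
    by_cases h : x = ⊤
    · exact ⟨x, le_rfl, fun h' => absurd h h'⟩
    · obtain ⟨y, h1, h2⟩ := exists_le_rank_eq_succ h
      exact ⟨y, h1, fun _ => h2⟩
  choose S hS1 hS2 using this
  refine ⟨fun a => S^[a] ⊥, monotone_nat_of_le_succ fun a => ?_, fun a => ?_⟩
  · rw [Function.iterate_succ_apply']
    exact hS1 _
  · induction a with
    | zero => exact fun _ => rank_bot
    | succ a ih =>
      intro ha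
      have h1 := ih (by omega)
      simp only [Function.iterate_succ_apply'] at h1 ⊢
      rw [hS2, h1]
      intro h2
      rw [h2, rank_top] at h1
      omega

end Rank

theorem sum_toType (s : Multiset ℕ) : ∑ i : s.ToType, i.1 = s.sum := by
  conv_rhs => rw [← Multiset.map_univ_coe s]
  rfl

theorem exists_chain_properPart (s : Multiset ℕ) :
    ∃ c : Fin (s.sum - 1) → ProperPart s, Function.Injective c ∧ ∀ a b, Comp (c a) (c b) := by
  obtain ⟨f, hf, hr⟩ := exists_maximal_chain fun i : s.ToType => i.1
  rw [sum_toType] at hr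
  refine ⟨fun a => ⟨f (a + 1), ?_, ?_⟩, ?_, ?_⟩
  · intro h
    have := hr (a + 1) (by omega)
    rw [h, rank_bot] at this
    omega
  · intro h
    have := hr (a + 1) (by omega)
    rw [h, rank_top, sum_toType] at this
    omega
  · intro a b h
    have h1 := congrArg rank (congrArg Subtype.val h)
    simp only at h1
    rw [hr _ (by omega), hr _ (by omega)] at h1
    exact Fin.ext (by omega)
  · intro a b
    rcases le_total a b with h | h
    · exact Or.inl (hf (Nat.add_le_add_right h 1))
    · exact Or.inr (hf (Nat.add_le_add_right h 1))

theorem eq_of_comp_of_rank_eq {s : Multiset ℕ} {x y : ProperPart s} (h : Comp x y)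
    (hr : rank x.1 = rank y.1) : x = y := by
  refine Subtype.ext ?_
  rcases h with h | h
  · exact (eq_or_lt_of_le (α := Chains _) h).resolve_right fun h' => (rank_strictMono h').ne hr
  · exact ((eq_or_lt_of_le (α := Chains _) h).resolve_right
      fun h' => (rank_strictMono h').ne hr.symm).symm

/-- Proper elements have ranks from $1$ to $|\sigma|-1$, and a maximal chain attains each of them
once; a largest face of the join unites maximal chains of the members. -/
theorem hasDim_join_iff {J : Type} [Fintype J] (s : J → Multiset ℕ) (t : ℕ) :
    HasDim (join fun j => orderComplex (ProperPart (s j))) t ↔ ∑ j, ((s j).sum - 1) = t + 1 := by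
  classical
  have hflag := isFlagOf_join fun j => ProperPart (s j)
  have hup : ∀ F ∈ (join fun j => orderComplex (ProperPart (s j))).faces,
      F.card ≤ ∑ j, ((s j).sum - 1) := by
    intro F hF
    have h2 := ((hflag.mem_faces F).1 hF).2.2
    have hcard : (Finset.univ.sigma fun j => Finset.range ((s j).sum - 1)).card =
      ∑ j, ((s j).sum - 1) := by simp
    rw [← hcard]
    -- A face is determined by member and rank of its vertices, because comparable elements of equal
    -- rank coincide.
    refine Finset.card_le_card_of_injOn
      (fun u => (⟨u.1, rank u.2.1 - 1⟩ : Σ _ : J, ℕ)) ?_ ?_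
    · intro u _
      have h3 := rank_pos u.2.2.1
      have h4 := rank_lt u.2.2.2
      rw [sum_toType] at h4
      simp
      omega
    · rintro ⟨i, x⟩ hu ⟨j, y⟩ hv huv
      obtain ⟨rfl, h3⟩ := Sigma.mk.inj_iff.1 huv
      have h4 := rank_pos x.2.1
      have h5 := rank_pos y.2.1
      have h6 : rank x.1 - 1 = rank y.1 - 1 := eq_of_heq h3
      have := eq_of_comp_of_rank_eq ((joinRel_mk_iff (P := fun j => ProperPart (s j))).1
        (h2 _ _ hu hv)) (by omega)
      rw [this]
  have hlow : 0 < ∑ j, ((s j).sum - 1) →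
      ∃ F ∈ (join fun j => orderComplex (ProperPart (s j))).faces,
        F.card = ∑ j, ((s j).sum - 1) := by
    intro hpos
    choose c hc hcomp using fun j => exists_chain_properPart (s j)
    let g : (Σ j, Fin ((s j).sum - 1)) → Σ j, ProperPart (s j) := Sigma.map id c
    have hg : Function.Injective g := Function.injective_id.sigma_map hc
    have hcard : (Finset.univ.image g).card = ∑ j, ((s j).sum - 1) := by
      rw [Finset.card_image_of_injective _ hg]
      simp
    refine ⟨Finset.univ.image g, (hflag.mem_faces _).2 ⟨?_, ?_, ?_⟩, hcard⟩
    · rw [← Finset.card_pos, hcard]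
      exact hpos
    · simp
    · intro u v hu hv
      obtain ⟨⟨i, a⟩, -, rfl⟩ := Finset.mem_image.1 hu
      obtain ⟨⟨j, b⟩, -, rfl⟩ := Finset.mem_image.1 hv
      by_cases h : i = j
      · subst h
        exact (joinRel_mk_iff (P := fun j => ProperPart (s j))).2 (hcomp i a b)
      · exact joinRel_of_ne h
  constructor
  · rintro ⟨⟨F, hF, hFc⟩, h2⟩
    have h3 := hup F hF
    obtain ⟨G, hG, hGc⟩ := hlow (by omega)
    have h4 := h2 ⟨G, hG, rfl⟩
    omega
  · intro h
    obtain ⟨G, hG, hGc⟩ := hlow (by omega)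
    refine ⟨⟨G, hG, hGc.trans h⟩, ?_⟩
    rintro _ ⟨F, hF, rfl⟩
    exact (hup F hF).trans_eq h

/-- The multisets of positive integers with at least two elements. -/
def MultiPart (σ : Multiset ℕ) : Prop := 0 ∉ σ ∧ 2 ≤ σ.card

theorem MultiPart.two_le_sum {σ : Multiset ℕ} (h : MultiPart σ) : 2 ≤ σ.sum := by
  have := Multiset.card_nsmul_le_sum (s := σ) (a := 1) fun x hx =>
    Nat.one_le_iff_ne_zero.2 fun h0 => h.1 (h0 ▸ hx)
  have h2 := h.2
  simp at this
  omega

theorem MultiPart.ne_zero {σ : Multiset ℕ} (h : MultiPart σ) : σ ≠ 0 := by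
  rintro rfl
  exact absurd h.2 (by simp)

/-- The weight of a multiset of multisets. -/
def weight (M : Multiset (Multiset ℕ)) : ℕ := (M.map fun σ => σ.sum - 1).sum

theorem joinType_congr {J J' : Type} {s : J → Multiset ℕ} {s' : J' → Multiset ℕ} (e : J ≃ J')
    (he : ∀ j, s' (e j) = s j) : joinType s = joinType s' := by
  have hF : ∀ j, ∃ F : ProperPart (s j) ≃ ProperPart (s' (e j)),
      ∀ a b, Comp a b ↔ Comp (F a) (F b) := by
    intro j
    rw [he j]
    exact ⟨Equiv.refl _, fun a b => Iff.rfl⟩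
  choose F hF using hF
  exact (joinType_eq_iff s s').2 ⟨e.sigmaCongr F,
    joinRel_sigmaCongr (P' := fun j => ProperPart (s' j)) e F hF⟩

/-- The type of a join does not depend on the indexing of its members, so families may be replaced
by multisets, on which the dimension condition becomes a weight condition. -/
theorem joinTypes_eq (t : ℕ) : joinTypes t =
    (fun M : Multiset (Multiset ℕ) => joinType fun σ : M.ToType => σ.1) ''
      {M | (∀ σ ∈ M, MultiPart σ) ∧ weight M = t + 1} := by
  classical
  ext c
  constructor
  · rintro ⟨r, n, σ, h2, hdim, rfl⟩
    have hdim' := (hasDim_join_iff (fun i => (σ i).parts) t).1 hdim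
    have hm : ∀ i, MultiPart (σ i).parts := fun i =>
      ⟨fun h => (lt_irrefl 0 ((σ i).parts_pos h)), h2 i⟩
    let M : Multiset (Multiset ℕ) := Finset.univ.val.map fun i => (σ i).parts
    have hM : ∀ τ ∈ M, MultiPart τ := by
      intro τ hτ
      obtain ⟨i, -, rfl⟩ := Multiset.mem_map.1 hτ
      exact hm i
    refine ⟨M, ⟨hM, ?_⟩, ?_⟩
    · rw [← hdim', weight, Multiset.map_map]
      rfl
    · change joinType (fun τ : M.ToType => τ.1) = joinType fun i => (σ i).parts
      obtain ⟨e, he⟩ := exists_equiv_of_map_univ_eq (fun τ : M.ToType => τ.1)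
        (fun i => (σ i).parts) (Multiset.map_univ_coe M)
      exact joinType_congr e he
  · rintro ⟨M, ⟨hM, hw⟩, rfl⟩
    let e := (Fintype.equivFin M.ToType).symm
    let σ : ∀ i, ((e i).1.sum).Partition := fun i =>
      ⟨(e i).1, fun {a} ha => Nat.pos_of_ne_zero fun h0 =>
        (hM _ Multiset.coe_mem).1 (h0 ▸ ha), rfl⟩
    have hc : joinType (fun σ : M.ToType => σ.1) = joinType fun i => (σ i).parts :=
      joinType_congr e.symm fun j => congrArg Sigma.fst (e.apply_symm_apply j)
    refine ⟨_, _, σ, fun i => (hM _ Multiset.coe_mem).2, ?_, hc⟩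
    refine (hasDim_join_iff (fun i => (σ i).parts) t).2 ?_
    rw [← hw, weight]
    conv_rhs => rw [← Multiset.map_univ_coe M, Multiset.map_map]
    exact Fintype.sum_equiv e _ _ fun i => rfl

/-! ### Counting multisets by weight -/

section Weighted

variable {A : Type*} (w : A → ℕ)

/-- Glue multisets in the fibres of `w` to a multiset. -/
def glueFibers (m : Multiset ℕ) (f : ∀ n : m.toFinset, Sym {a // w a = n.1} (m.count n.1)) :
    Multiset A :=
  ∑ n, (f n).1.map Subtype.val

theorem map_glueFibers (m : Multiset ℕ)
    (f : ∀ n : m.toFinset, Sym {a // w a = n.1} (m.count n.1)) :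
    (glueFibers w m f).map w = m := by
  classical
  have h : ∀ n : m.toFinset, ((f n).1.map Subtype.val).map w = m.count n.1 • {n.1} := by
    intro n
    rw [Multiset.map_map, Multiset.nsmul_singleton]
    refine Multiset.eq_replicate.2 ⟨by simp, fun b hb => ?_⟩
    obtain ⟨a, -, rfl⟩ := Multiset.mem_map.1 hb
    exact a.2
  have := map_sum (Multiset.mapAddMonoidHom w) (fun n => (f n).1.map Subtype.val) Finset.univ
  refine Eq.trans this ?_
  simp only [Multiset.coe_mapAddMonoidHom, h]
  rw [Finset.sum_coe_sort m.toFinset fun n => m.count n • ({n} : Multiset ℕ)]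
  exact Multiset.toFinset_sum_count_nsmul_eq m

theorem count_glueFibers [DecidableEq A] (m : Multiset ℕ)
    (f : ∀ n : m.toFinset, Sym {a // w a = n.1} (m.count n.1)) (n : m.toFinset)
    (a : {a // w a = n.1}) : (glueFibers w m f).count a.1 = (f n).1.count a := by
  rw [glueFibers, Multiset.count_sum', Finset.sum_eq_single n]
  · exact Multiset.count_map_eq_count' _ _ Subtype.val_injective _
  · intro k _ hk
    refine Multiset.count_eq_zero_of_notMem fun h => hk ?_
    obtain ⟨b, -, hb⟩ := Multiset.mem_map.1 h
    refine Subtype.ext ?_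
    rw [← b.2, hb, a.2]
  · simp

theorem glueFibers_injective (m : Multiset ℕ) : Function.Injective (glueFibers w m) := by
  classical
  intro f f' h
  funext n
  refine Subtype.ext (Multiset.ext.2 fun a => ?_)
  have h1 := count_glueFibers w m f n a
  rw [h, count_glueFibers] at h1
  exact h1.symm

/-- The pieces are the submultisets of `M` of constant weight. -/
theorem exists_glueFibers_eq (M : Multiset A) : ∃ f, glueFibers w (M.map w) f = M := by
  classical
  have h : ∀ n : (M.map w).toFinset, ∃ N : Sym {a // w a = n.1} ((M.map w).count n.1),
      N.1.map Subtype.val = M.filter fun a => w a = n.1 := by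
    intro n
    have hN : ∀ a ∈ M.filter fun a => w a = n.1, w a = n.1 := fun a ha =>
      (Multiset.mem_filter.1 ha).2
    lift (M.filter fun a => w a = n.1) to Multiset {a // w a = n.1} using hN with N hN'
    refine ⟨⟨N, ?_⟩, rfl⟩
    rw [Multiset.count_map, ← Multiset.card_map Subtype.val N, hN']
    simp only [eq_comm]
  choose f hf using h
  refine ⟨f, Multiset.ext.2 fun a => ?_⟩
  by_cases ha : a ∈ M
  · have hmem : w a ∈ (M.map w).toFinset := Multiset.mem_toFinset.2 (Multiset.mem_map_of_mem w ha)
    rw [count_glueFibers w _ f ⟨w a, hmem⟩ ⟨a, rfl⟩]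
    rw [← Multiset.count_map_eq_count' Subtype.val _ Subtype.val_injective, hf,
      Multiset.count_filter_of_pos (p := fun b => w b = w a) rfl]
  · rw [Multiset.count_eq_zero_of_notMem ha]
    refine Multiset.count_eq_zero_of_notMem fun h => ha ?_
    obtain ⟨n, -, hn⟩ := Multiset.mem_sum.1 h
    rw [hf] at hn
    exact Multiset.mem_of_mem_filter hn

/-- A multiset with given weights consists of multisets in the fibres. -/
noncomputable def glueEquiv (m : Multiset ℕ) :
    (∀ n : m.toFinset, Sym {a // w a = n.1} (m.count n.1)) ≃ {M : Multiset A // M.map w = m} := by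
  refine Equiv.ofBijective (fun f => ⟨glueFibers w m f, map_glueFibers w m f⟩) ⟨?_, ?_⟩
  · intro f f' h
    exact glueFibers_injective w m (congrArg Subtype.val h)
  · rintro ⟨M, rfl⟩
    obtain ⟨f, hf⟩ := exists_glueFibers_eq w M
    exact ⟨f, Subtype.ext hf⟩

/-- Once the multiset of weights is fixed, the elements of each distinct weight are chosen
independently, as a multiset of prescribed size. -/
theorem card_map_eq (m : Multiset ℕ) (hfin : ∀ n ∈ m, Finite {a // w a = n}) :
    Finite {M : Multiset A // M.map w = m} ∧ Nat.card {M : Multiset A // M.map w = m} =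
      ∏ n ∈ m.toFinset, (Nat.card {a // w a = n}).multichoose (m.count n) := by
  classical
  have hf : ∀ n : m.toFinset, Fintype {a // w a = n.1} := fun n =>
    have := hfin n.1 (Multiset.mem_toFinset.1 n.2)
    Fintype.ofFinite _
  refine ⟨Finite.of_equiv _ (glueEquiv w m), ?_⟩
  rw [← Nat.card_congr (glueEquiv w m), Nat.card_pi, ← Finset.prod_coe_sort m.toFinset
    fun n => (Nat.card {a // w a = n}).multichoose (m.count n)]
  refine Finset.prod_congr rfl fun n _ => ?_
  have := hf n
  rw [Nat.card_eq_fintype_card, Sym.card_sym_eq_multichoose, Nat.card_eq_fintype_card]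

/-- Multisets of weight `t` are multisets over partitions of `t`. -/
def weightEquiv (hw : ∀ a, 0 < w a) (t : ℕ) : {M : Multiset A // (M.map w).sum = t} ≃
    Σ μ : t.Partition, {M : Multiset A // M.map w = μ.parts} where
  toFun M := ⟨⟨M.1.map w, fun {i} hi => by
    obtain ⟨a, -, rfl⟩ := Multiset.mem_map.1 hi
    exact hw a, M.2⟩, M.1, rfl⟩
  invFun M := ⟨M.2.1, by rw [M.2.2, M.1.parts_sum]⟩
  left_inv M := rfl
  right_inv := by
    rintro ⟨⟨p, h1, h2⟩, M, hM⟩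
    change M.map w = p at hM
    subst hM
    rfl

theorem card_weight_eq (hw : ∀ a, 0 < w a) (hfin : ∀ n, 0 < n → Finite {a // w a = n}) (t : ℕ) :
    ENat.card {M : Multiset A // (M.map w).sum = t} =
      ((∑ μ : t.Partition, ∏ n ∈ μ.parts.toFinset,
        (Nat.card {a // w a = n}).multichoose (μ.parts.count n) : ℕ) : ℕ∞) := by
  have h : ∀ μ : t.Partition, _ := fun μ =>
    card_map_eq w μ.parts fun n hn => hfin n (μ.parts_pos hn)
  have hf : ∀ μ : t.Partition, Finite {M : Multiset A // M.map w = μ.parts} := fun μ => (h μ).1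
  rw [ENat.card_congr (weightEquiv w hw t), ENat.card_eq_coe_natCard, Nat.card_sigma]
  exact congrArg _ (Finset.sum_congr rfl fun μ _ => (h μ).2)

end Weighted

/-- Only the partition with a single part is excluded. -/
theorem card_partition_two_le (n : ℕ) :
    Nat.card {p : (n + 1).Partition // 2 ≤ p.parts.card} = Fintype.card (n + 1).Partition - 1 := by
  classical
  have h1 : Nat.card {p : (n + 1).Partition // ¬ 2 ≤ p.parts.card} = 1 := by
    rw [Nat.card_eq_one_iff_exists]
    refine ⟨⟨Nat.Partition.indiscrete (n + 1), by simp⟩, ?_⟩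
    rintro ⟨p, hp⟩
    refine Subtype.ext (Nat.Partition.ext ?_)
    have hne : p.parts ≠ 0 := fun h => by
      have := p.parts_sum
      simp [h] at this
    have hc : p.parts.card = 1 := by
      have := Multiset.card_pos.2 hne
      omega
    obtain ⟨a, ha⟩ := Multiset.card_eq_one.1 hc
    have := p.parts_sum
    rw [ha, Multiset.sum_singleton] at this
    simp [ha, this]
  have h2 := Nat.card_congr (Equiv.sumCompl fun p : (n + 1).Partition => 2 ≤ p.parts.card)
  rw [Nat.card_sum, h1, Nat.card_eq_fintype_card (α := (n + 1).Partition)] at h2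
  omega

/-- Multisets with at least two positive elements and sum `n + 1` are partitions. -/
def multiPartEquiv {n : ℕ} (hn : 0 < n) : {σ : {σ // MultiPart σ} // σ.1.sum - 1 = n} ≃
    {p : (n + 1).Partition // 2 ≤ p.parts.card} where
  toFun σ := ⟨⟨σ.1.1, fun {i} hi => Nat.pos_of_ne_zero fun h => σ.1.2.1 (h ▸ hi), by
    have := σ.2
    omega⟩, σ.1.2.2⟩
  invFun p := ⟨⟨p.1.parts, fun h => lt_irrefl 0 (p.1.parts_pos h), p.2⟩, by
    simp [p.1.parts_sum]⟩
  left_inv σ := rfl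
  right_inv p := rfl

theorem encard_weight (t : ℕ) :
    {M | (∀ σ ∈ M, MultiPart σ) ∧ weight M = t}.encard =
      ((∑ μ : t.Partition, ∏ n ∈ μ.parts.toFinset,
        Nat.multichoose (Fintype.card (n + 1).Partition - 1) (μ.parts.count n) : ℕ) : ℕ∞) := by
  classical
  let w : {σ // MultiPart σ} → ℕ := fun σ => σ.1.sum - 1
  have hw : ∀ a, 0 < w a := fun a => by
    have := a.2.two_le_sum
    change 0 < a.1.sum - 1
    omega
  have h1 : {M | (∀ σ ∈ M, MultiPart σ) ∧ weight M = t} =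
      Multiset.map Subtype.val '' {M : Multiset {σ // MultiPart σ} | (M.map w).sum = t} := by
    ext M
    constructor
    · rintro ⟨hM, h⟩
      lift M to Multiset {σ // MultiPart σ} using hM
      refine ⟨M, ?_, rfl⟩
      rw [weight, Multiset.map_map] at h
      exact h
    · rintro ⟨M, h, rfl⟩
      refine ⟨?_, ?_⟩
      · intro σ hσ
        obtain ⟨τ, -, rfl⟩ := Multiset.mem_map.1 hσ
        exact τ.2
      · rw [weight, Multiset.map_map]
        exact h
  rw [h1, (Multiset.map_injective Subtype.val_injective).encard_image, Set.encard]
  have hfin : ∀ n, 0 < n → Finite {a // w a = n} := fun n hn => Finite.of_equiv _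
    (multiPartEquiv hn).symm
  refine (card_weight_eq w hw hfin t).trans ?_
  congr 1
  refine Finset.sum_congr rfl fun μ _ => Finset.prod_congr rfl fun n hn => ?_
  have hn' : 0 < n := μ.parts_pos (Multiset.mem_toFinset.1 hn)
  rw [Nat.card_congr (multiPartEquiv hn'), card_partition_two_le]

theorem core_toType {M : Multiset (Multiset ℕ)} (hM : ∀ σ ∈ M, MultiPart σ) :
    core (fun σ : M.ToType => σ.1) = M := by
  rw [core]
  refine (congrArg _ (Multiset.map_univ_coe M)).trans ?_
  exact Multiset.filter_eq_self.2 fun σ hσ => (hM σ hσ).2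

/-- When all members have at least two parts, the core is the whole multiset, so distinct multisets
give distinct types. -/
theorem Q_eq_encard_weight (t : ℕ) :
    Q t = {M | (∀ σ ∈ M, MultiPart σ) ∧ weight M = t + 1}.encard := by
  rw [Q, joinTypes_eq]
  refine Set.InjOn.encard_image ?_
  rintro M ⟨hM, -⟩ M' ⟨hM', -⟩ h
  have h1 := ((joinType_eq_iff_core (fun j => (hM _ Multiset.coe_mem).1)
    (fun j => (hM' _ Multiset.coe_mem).1) (fun j => (hM _ Multiset.coe_mem).ne_zero)
    (fun j => (hM' _ Multiset.coe_mem).ne_zero)).1 h).1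
  rwa [core_toType hM, core_toType hM'] at h1

/-! ### Gaps of a chain -/

/-- Going up from `⊥`, take the last step before the chain ceases to lie below `y`; comparability
turns "not below" into "above". -/
theorem exists_gap {P : Type*} [PartialOrder P] [BoundedOrder P] {m : ℕ} {x : Fin (m + 2) → P}
    (h0 : x 0 = ⊥) (h1 : x (Fin.last _) = ⊤) {y : P} (hy : ∀ j, Comp y (x j) ∧ y ≠ x j) :
    ∃ j : Fin (m + 1), x j.castSucc < y ∧ y < x j.succ := by
  have : ∃ j : Fin (m + 1), x j.castSucc ≤ y ∧ ¬ x j.succ ≤ y := by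
    by_contra! hc
    have h2 : ∀ j, x j ≤ y := by
      intro j
      induction j using Fin.induction with
      | zero => exact h0.trans_le bot_le
      | succ j ih => exact hc j ih
    exact (hy _).2 (le_antisymm (h1 ▸ le_top) (h2 (Fin.last _)))
  obtain ⟨j, h2, h3⟩ := this
  exact ⟨j, lt_of_le_of_ne h2 (hy _).2.symm, lt_of_le_of_ne ((hy _).1.resolve_right h3) (hy _).2⟩

/-- The elements comparable to all elements of a chain from `⊥` to `⊤` lie in its gaps. -/
theorem exists_gaps_equiv {P : Type*} [PartialOrder P] [BoundedOrder P] {m : ℕ}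
    {x : Fin (m + 2) → P} (hx : StrictMono x) (h0 : x 0 = ⊥) (h1 : x (Fin.last _) = ⊤) :
    ∃ e : (Σ j : Fin (m + 1), {y // x j.castSucc < y ∧ y < x j.succ}) ≃
      {y // ∀ j, Comp y (x j) ∧ y ≠ x j}, ∀ u v, JoinRel u v ↔ Comp (e u).1 (e v).1 := by
  -- Elements of different gaps are always comparable; this is why the gaps form a join.
  have hlt : ∀ {i j : Fin (m + 1)} {y z : P}, i < j → y < x i.succ → x j.castSucc < z → y < z :=
    fun hij hy hz => hy.trans ((hx.monotone (Fin.succ_le_castSucc_iff.2 hij)).trans_lt hz)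
  refine ⟨Equiv.ofBijective (fun u => ⟨u.2.1, fun j => ?_⟩) ⟨?_, ?_⟩, ?_⟩
  · rcases lt_or_ge u.1.castSucc j with h | h
    · have := u.2.2.2.trans_le (hx.monotone (Fin.castSucc_lt_iff_succ_le.1 h))
      exact ⟨Or.inl this.le, this.ne⟩
    · have := (hx.monotone h).trans_lt u.2.2.1
      exact ⟨Or.inr this.le, this.ne'⟩
  · rintro ⟨i, y, hy⟩ ⟨j, z, hz⟩ h
    obtain rfl : y = z := congrArg Subtype.val h
    rcases lt_trichotomy i j with hij | rfl | hij
    · exact absurd (hlt hij hy.2 hz.1) (lt_irrefl _)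
    · rfl
    · exact absurd (hlt hij hz.2 hy.1) (lt_irrefl _)
  · rintro ⟨y, hy⟩
    obtain ⟨j, hj⟩ := exists_gap h0 h1 hy
    exact ⟨⟨j, y, hj⟩, rfl⟩
  · rintro ⟨i, y, hy⟩ ⟨j, z, hz⟩
    rcases lt_trichotomy i j with hij | rfl | hij
    · exact iff_of_true (joinRel_of_ne hij.ne) (Or.inl (hlt hij hy.2 hz.1).le)
    · exact joinRel_mk_iff
    · exact iff_of_true (joinRel_of_ne hij.ne') (Or.inr (hlt hij hz.2 hy.1).le)

/-! ### Intervals in products of chains -/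

section Interval

variable {ι : Type*} [Fintype ι]

/-- The nonzero values of a function. -/
def parts (e : ι → ℕ) : Multiset ℕ := (Finset.univ.val.map e).filter (· ≠ 0)

theorem zero_notMem_parts (e : ι → ℕ) : 0 ∉ parts e := by
  simp [parts]

theorem sum_parts (e : ι → ℕ) : (parts e).sum = ∑ i, e i := by
  have h := Multiset.sum_filter_add_sum_filter_not (s := Finset.univ.val.map e) (· ≠ 0)
  have h2 : ((Finset.univ.val.map e).filter fun a => ¬ a ≠ 0).sum = 0 :=
    Multiset.sum_eq_zero fun a ha => not_not.1 (Multiset.mem_filter.1 ha).2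
  rw [h2, add_zero] at h
  exact h

theorem exists_parts_equiv (e : ι → ℕ) :
    ∃ f : {i // e i ≠ 0} ≃ (parts e).ToType, ∀ i, (f i).1 = e i := by
  classical
  refine exists_equiv_of_map_univ_eq (fun i : {i // e i ≠ 0} => e i.1)
    (fun t : (parts e).ToType => t.1) ?_
  rw [Multiset.map_univ_coe, parts, Multiset.filter_map]
  exact Finset.univ_val_map_subtype_restrict e fun i => e i ≠ 0

variable {d : ι → ℕ}

/-- Subtract `a` and forget the coordinates in which `a` and `b` agree. Dropping them is harmless,
since every element of the interval has the same value there. -/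
theorem exists_Icc_map (a b : Chains d) (hab : a ≤ b) :
    ∃ F : {y // a ≤ y ∧ y ≤ b} →
        Chains (fun t : (parts fun i => (b i : ℕ) - (a i : ℕ)).ToType => t.1),
      (∀ y z, F y ≤ F z ↔ y ≤ z) ∧ Function.Surjective F ∧
      F ⟨a, le_rfl, hab⟩ = ⊥ ∧ F ⟨b, hab, le_rfl⟩ = ⊤ := by
  obtain ⟨f, hf⟩ := exists_parts_equiv fun i => (b i : ℕ) - (a i : ℕ)
  have hf' : ∀ t, (b (f.symm t).1 : ℕ) - (a (f.symm t).1 : ℕ) = t.1 := fun t => by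
    rw [← hf, f.apply_symm_apply]
  have hab' : ∀ i, (a i : ℕ) ≤ b i := fun i => hab i
  refine ⟨fun y t => ⟨(y.1 (f.symm t).1 : ℕ) - (a (f.symm t).1 : ℕ), ?_⟩, ?_, ?_, ?_, ?_⟩
  · have h1 := hf' t
    have h2 : (y.1 (f.symm t).1 : ℕ) ≤ b (f.symm t).1 := y.2.2 _
    change _ < t.1 + 1
    omega
  · intro y z
    have hy1 : ∀ i, (a i : ℕ) ≤ y.1 i := fun i => y.2.1 i
    have hy2 : ∀ i, (y.1 i : ℕ) ≤ b i := fun i => y.2.2 i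
    have hz1 : ∀ i, (a i : ℕ) ≤ z.1 i := fun i => z.2.1 i
    constructor
    · intro h i
      by_cases hi : (b i : ℕ) - (a i : ℕ) = 0
      · have := hy1 i
        have := hy2 i
        have := hz1 i
        exact Fin.le_def.2 (by omega)
      · have h1 : (y.1 (f.symm (f ⟨i, hi⟩)).1 : ℕ) - (a (f.symm (f ⟨i, hi⟩)).1 : ℕ) ≤
          (z.1 (f.symm (f ⟨i, hi⟩)).1 : ℕ) - (a (f.symm (f ⟨i, hi⟩)).1 : ℕ) := h (f ⟨i, hi⟩)
        rw [f.symm_apply_apply] at h1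
        have := hy1 i
        have := hz1 i
        exact Fin.le_def.2 (by simp only at h1; omega)
    · intro h t
      exact Nat.sub_le_sub_right (h (f.symm t).1) _
  · intro z
    have hz : ∀ i h, (z (f ⟨i, h⟩) : ℕ) ≤ (b i : ℕ) - (a i : ℕ) := fun i h => by
      have h1 : (z (f ⟨i, h⟩) : ℕ) < (f ⟨i, h⟩).1 + 1 := (z (f ⟨i, h⟩)).2
      have h2 := hf ⟨i, h⟩
      simp only at h2
      omega
    have hb : ∀ i, (b i : ℕ) ≤ d i := fun i => Nat.lt_succ_iff.1 (b i).2
    have hle : ∀ i, (a i : ℕ) + (if h : (b i : ℕ) - (a i : ℕ) ≠ 0 then (z (f ⟨i, h⟩) : ℕ) else 0) ≤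
        b i := by
      intro i
      have := hab' i
      split_ifs with h
      · have := hz i h
        omega
      · omega
    refine ⟨⟨fun i => ⟨(a i : ℕ) +
      if h : (b i : ℕ) - (a i : ℕ) ≠ 0 then (z (f ⟨i, h⟩) : ℕ) else 0,
      Nat.lt_succ_iff.2 ((hle i).trans (hb i))⟩, fun i => ?_, fun i => hle i⟩, ?_⟩
    · exact Nat.le_add_right _ _
    · funext t
      refine Fin.ext ?_
      have h : (b (f.symm t).1 : ℕ) - (a (f.symm t).1 : ℕ) ≠ 0 := (f.symm t).2
      change (a (f.symm t).1 : ℕ) + dite _ _ _ - (a (f.symm t).1 : ℕ) = z t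
      rw [dif_pos h, Nat.add_sub_cancel_left]
      exact congrArg (fun t => (z t : ℕ)) (f.apply_symm_apply t)
  · funext t
    exact Fin.ext (Nat.sub_self _)
  · funext t
    exact Fin.ext (hf' t)

theorem exists_Ioo_equiv (a b : Chains d) (hab : a ≤ b) :
    ∃ F : {y // a < y ∧ y < b} ≃ ProperPart (parts fun i => (b i : ℕ) - (a i : ℕ)),
      ∀ y z, Comp y z ↔ Comp (F y) (F z) := by
  obtain ⟨F, hF, hsurj, hbot, htop⟩ := exists_Icc_map a b hab
  have hinj : Function.Injective F := fun y z h =>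
    le_antisymm ((hF _ _).1 h.le) ((hF _ _).1 h.ge)
  refine ⟨Equiv.ofBijective (fun y => ⟨F ⟨y.1, y.2.1.le, y.2.2.le⟩, ?_, ?_⟩) ⟨?_, ?_⟩, ?_⟩
  · intro h
    exact y.2.1.ne (congrArg Subtype.val (hinj (h.trans hbot.symm))).symm
  · intro h
    exact y.2.2.ne (congrArg Subtype.val (hinj (h.trans htop.symm)))
  · intro y z h
    have h2 := congrArg Subtype.val (hinj (congrArg Subtype.val h))
    exact Subtype.ext h2
  · rintro ⟨w, hw⟩
    obtain ⟨y, rfl⟩ := hsurj w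
    refine ⟨⟨y.1, lt_of_le_of_ne y.2.1 ?_, lt_of_le_of_ne y.2.2 ?_⟩, rfl⟩
    · intro h
      exact hw.1 (hbot ▸ congrArg F (Subtype.ext h.symm))
    · intro h
      exact hw.2 (htop ▸ congrArg F (Subtype.ext h))
  · intro y z
    have h : ∀ y z : {y // a < y ∧ y < b}, y ≤ z ↔
      F ⟨y.1, y.2.1.le, y.2.2.le⟩ ≤ F ⟨z.1, z.2.1.le, z.2.2.le⟩ := fun y z =>
      (hF ⟨y.1, y.2.1.le, y.2.2.le⟩ ⟨z.1, z.2.1.le, z.2.2.le⟩).symm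
    exact or_congr (h y z) (h z y)

/-- The nonzero differences in a gap of a chain. -/
def gapParts {m : ℕ} (x : Fin (m + 2) → Chains d) (j : Fin (m + 1)) : Multiset ℕ :=
  parts fun i => (x j.succ i : ℕ) - (x j.castSucc i : ℕ)

theorem exists_gapParts_equiv {m : ℕ} {x : Fin (m + 2) → Chains d} (hx : StrictMono x)
    (h0 : x 0 = ⊥) (h1 : x (Fin.last _) = ⊤) :
    ∃ e : {y // ∀ j, Comp y (x j) ∧ y ≠ x j} ≃ Σ j, ProperPart (gapParts x j),
      ∀ u v, Comp u.1 v.1 ↔ JoinRel (e u) (e v) := by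
  obtain ⟨e, he⟩ := exists_gaps_equiv hx h0 h1
  choose F hF using fun j : Fin (m + 1) => exists_Ioo_equiv (x j.castSucc) (x j.succ)
    (hx.monotone j.castSucc_lt_succ.le)
  refine ⟨e.symm.trans ((Equiv.refl _).sigmaCongr F), fun u v => ?_⟩
  have h2 := joinRel_sigmaCongr (P' := fun j => ProperPart (gapParts x j))
    (Equiv.refl (Fin (m + 1))) F hF (e.symm u) (e.symm v)
  rw [he, e.apply_symm_apply, e.apply_symm_apply] at h2
  exact h2

theorem sum_gapParts_eq {m : ℕ} {x : Fin (m + 2) → Chains d} (hx : StrictMono x)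
    (j : Fin (m + 1)) : (gapParts x j).sum = rank (x j.succ) - rank (x j.castSucc) := by
  rw [gapParts, sum_parts, rank, rank]
  exact Finset.sum_tsub_distrib _ fun i _ => hx.monotone j.castSucc_lt_succ.le i

theorem sum_sub_eq_of_monotone {n : ℕ} {g : Fin (n + 1) → ℕ} (hg : Monotone g) :
    ∑ j : Fin n, (g j.succ - g j.castSucc) = g (Fin.last n) - g 0 := by
  induction n with
  | zero => simp
  | succ n ih =>
    have h1 := ih (g := fun j => g j.castSucc) fun i j hij =>
      hg (Fin.castSucc_le_castSucc_iff.2 hij)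
    have h2 : g 0 ≤ g (Fin.last n).castSucc := hg (Fin.zero_le _)
    have h3 : g (Fin.last n).castSucc ≤ g (Fin.last (n + 1)) := hg (Fin.le_last _)
    rw [Fin.sum_univ_castSucc]
    simp only [Fin.castSucc_zero, ← Fin.succ_castSucc, Fin.succ_last,
      Nat.succ_eq_add_one] at h1 ⊢
    rw [h1]
    omega

/-- The differences of ranks along the chain telescope from `⊥` to `⊤`. -/
theorem sum_gapParts {m : ℕ} {x : Fin (m + 2) → Chains d} (hx : StrictMono x)
    (h0 : x 0 = ⊥) (h1 : x (Fin.last _) = ⊤) : ∑ j, (gapParts x j).sum = ∑ i, d i := by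
  simp only [sum_gapParts_eq hx]
  rw [sum_sub_eq_of_monotone (g := fun j => rank (x j)) (rank_strictMono.comp hx).monotone, h0, h1,
    rank_bot, rank_top, Nat.sub_zero]

theorem gapParts_ne_zero {m : ℕ} {x : Fin (m + 2) → Chains d} (hx : StrictMono x)
    (j : Fin (m + 1)) : gapParts x j ≠ 0 := by
  intro h
  have h1 := sum_gapParts_eq hx j
  have h2 := rank_strictMono (hx j.castSucc_lt_succ)
  rw [h] at h1
  simp at h1
  omega

/-- Pad the multiset with zeros to one value for each index; `parts` discards them again. -/
theorem exists_parts_eq (ι : Type*) [Fintype ι] {s : Multiset ℕ} (h0 : 0 ∉ s)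
    (h : s.card ≤ Fintype.card ι) : ∃ e : ι → ℕ, parts e = s := by
  classical
  let t := s + Multiset.replicate (Fintype.card ι - s.card) 0
  have ht : Fintype.card ι = Fintype.card t.ToType := by
    rw [Multiset.card_coe, Multiset.card_add, Multiset.card_replicate]
    omega
  have f := Fintype.equivOfCardEq ht
  have h1 : Finset.univ.val.map (fun i => (f i).1) = t := by
    exact (map_univ_eq_of_equiv (fun i => (f i).1) (fun j : t.ToType => j.1) f
      fun _ => rfl).trans (Multiset.map_univ_coe t)
  refine ⟨fun i => (f i).1, ?_⟩
  rw [parts, h1, Multiset.filter_add, Multiset.filter_eq_self.2, Multiset.filter_eq_nil.2,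
    add_zero]
  · intro a ha
    rw [Multiset.eq_of_mem_replicate ha]
    exact fun h => h rfl
  · rintro a ha rfl
    exact h0 ha

/-- Every sequence of multisets is the sequence of gaps of a chain. -/
theorem exists_chain_gapParts_eq (ι : Type*) [Fintype ι] {m : ℕ} (s : Fin (m + 1) → Multiset ℕ)
    (h0 : ∀ j, 0 ∉ s j) (hne : ∀ j, s j ≠ 0) (h : ∀ j, (s j).card ≤ Fintype.card ι) :
    ∃ (d : ι → ℕ) (x : Fin (m + 2) → Chains d), StrictMono x ∧ x 0 = ⊥ ∧ x (Fin.last _) = ⊤ ∧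
      gapParts x = s := by
  choose e he using fun j => exists_parts_eq ι (h0 j) (h j)
  -- The prescribed gaps are the increments, so the chain consists of their partial sums, and the
  -- last sum gives the lengths of the factors.
  let S : Fin (m + 2) → ι → ℕ := Fin.partialSum e
  have hS : ∀ j : Fin (m + 1), S j.succ = S j.castSucc + e j := Fin.partialSum_succ e
  have hmono : Monotone S := Fin.monotone_iff_le_succ.2 fun j => by
    rw [hS]
    exact le_self_add
  let x : Fin (m + 2) → Chains (S (Fin.last _)) := fun j i =>
    ⟨S j i, Nat.lt_succ_iff.2 (hmono (Fin.le_last j) i)⟩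
  have hx : Monotone x := fun i j hij k => hmono hij k
  have hgap : gapParts x = s := by
    funext j
    rw [← he, gapParts]
    congr 1
    funext i
    change S j.succ i - S j.castSucc i = e j i
    rw [hS, Pi.add_apply, Nat.add_sub_cancel_left]
  refine ⟨_, x, ?_, ?_, rfl, hgap⟩
  · refine Fin.strictMono_iff_lt_succ.2 fun j => lt_of_le_of_ne (hx j.castSucc_lt_succ.le) ?_
    intro heq
    refine hne j ?_
    rw [← hgap, gapParts, heq]
    simp only [parts, Nat.sub_self, Multiset.map_const', Multiset.filter_eq_nil]
    exact fun a ha h => h (Multiset.eq_of_mem_replicate ha)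
  · funext i
    refine Fin.ext ?_
    change S 0 i = 0
    simp [S, Fin.partialSum_zero]

end Interval

/-! ### The faces of the edgewise subdivision -/

/-- Two integer points are near if one of them exceeds the other by a `0/1`-vector. -/
def Near {ι : Type*} (x y : ι → ℤ) : Prop := (x ≤ y ∧ y ≤ x + 1) ∨ (y ≤ x ∧ x ≤ y + 1)

theorem Near.symm {ι : Type*} {x y : ι → ℤ} (h : Near x y) : Near y x := Or.symm h

theorem Near.refl {ι : Type*} (x : ι → ℤ) : Near x x :=
  Or.inl ⟨le_rfl, fun i => by simp⟩

theorem monotone_of_le_next {n : ℕ} {α : Type*} [Preorder α] {f : Fin n → α}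
    (h : ∀ i j : Fin n, (j : ℕ) = i + 1 → f i ≤ f j) : Monotone f := by
  cases n with
  | zero => exact fun i => i.elim0
  | succ n => exact Fin.monotone_iff_le_succ.2 fun i => h _ _ (by simp)

section Faces

variable {k q : ℕ}

/-- The point of index `a` raises the positions `≥ a`. Consistency puts `i` before `i + 1` when
their values agree, so raising `i` entails raising `i + 1` and monotonicity survives. -/
theorem mem_vertices_of_mem_facet {v z : Fin (k - 1) → ℤ} {π : Equiv.Perm (Fin (k - 1))}
    (hv : v ∈ vertices k q) (hv1 : v + 1 ∈ vertices k q) (hπ : Consistent v π)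
    (hz : z ∈ facet v π) : z ∈ vertices k q := by
  obtain ⟨a, -, rfl⟩ := Finset.mem_image.1 hz
  refine ⟨monotone_of_le_next fun i j hij => ?_, fun i => ?_⟩
  · have h1 : v i ≤ v j := hv.1 (Fin.le_def.2 (by omega))
    by_cases h : v i = v j
    · have h2 : (π.symm i : ℕ) < π.symm j := hπ i j hij h
      split_ifs <;> omega
    · split_ifs <;> omega
  · have h1 := (hv.2 i).1
    have h2 := (hv1.2 i).2
    simp only [Pi.add_apply, Pi.one_apply] at h2
    simp only
    split_ifs <;> omega

theorem near_of_mem_facet {v y z : Fin (k - 1) → ℤ} {π : Equiv.Perm (Fin (k - 1))}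
    (hy : y ∈ facet v π) (hz : z ∈ facet v π) : Near y z := by
  obtain ⟨a, -, rfl⟩ := Finset.mem_image.1 hy
  obtain ⟨a', -, rfl⟩ := Finset.mem_image.1 hz
  rcases le_total a a' with h | h
  · refine Or.inr ⟨fun i => ?_, fun i => ?_⟩ <;> simp only [Pi.add_apply, Pi.one_apply] <;>
      split_ifs <;> omega
  · refine Or.inl ⟨fun i => ?_, fun i => ?_⟩ <;> simp only [Pi.add_apply, Pi.one_apply] <;>
      split_ifs <;> omega

theorem exists_threshold {n : ℕ} {P : Fin n → Prop} (h : ∀ i j, i ≤ j → P i → P j) :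
    ∃ a ≤ n, ∀ i, P i ↔ a ≤ (i : ℕ) := by
  classical
  have hex : ∃ a, ∀ i : Fin n, a ≤ (i : ℕ) → P i := ⟨n, fun i hi => absurd i.2 (not_lt.2 hi)⟩
  refine ⟨Nat.find hex, Nat.find_min' hex fun i hi => absurd i.2 (not_lt.2 hi), fun i => ?_⟩
  exact ⟨fun hi => Nat.find_min' hex fun j hj => h i j hj hi, fun hi => Nat.find_spec hex i hi⟩

/-- A chain of points between `v` and `v + 1` lies in a facet. -/
theorem exists_consistent_perm {v : Fin (k - 1) → ℤ} {s : Finset (Fin (k - 1) → ℤ)}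
    (hs : ∀ z ∈ s, Monotone z ∧ v ≤ z ∧ z ≤ v + 1) (hc : ∀ y ∈ s, ∀ z ∈ s, y ≤ z ∨ z ≤ y) :
    ∃ π, Consistent v π ∧ s ⊆ facet v π := by
  classical
  -- Coordinates raised by more points of the chain must come later in the permutation; ties are
  -- broken by the index, which secures consistency.
  let cnt : Fin (k - 1) → ℕ := fun c => (s.filter fun z => z c = v c + 1).card
  let f : Fin (k - 1) → ℕ ×ₗ Fin (k - 1) := fun c => toLex (cnt c, c)
  have hf : Function.Injective f := fun c d h => congrArg (fun p => (ofLex p).2) h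
  have hmono : StrictMono (f ∘ Tuple.sort f) :=
    (Tuple.monotone_sort f).strictMono_of_injective (hf.comp (Tuple.sort f).injective)
  have hlt : ∀ c d, (Tuple.sort f).symm c < (Tuple.sort f).symm d ↔ f c < f d := by
    intro c d
    rw [← hmono.lt_iff_lt]
    simp
  refine ⟨Tuple.sort f, ?_, ?_⟩
  · intro i j hij hv
    rw [hlt, Prod.Lex.toLex_lt_toLex]
    have hle : cnt i ≤ cnt j := by
      refine Finset.card_le_card fun z hz => ?_
      obtain ⟨hz, hzi⟩ := Finset.mem_filter.1 hz
      refine Finset.mem_filter.2 ⟨hz, ?_⟩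
      have h1 := (hs z hz).1 (show i ≤ j from Fin.le_def.2 (by omega))
      have h2 := (hs z hz).2.2 j
      simp only [Pi.add_apply, Pi.one_apply] at h2
      omega
    rcases hle.lt_or_eq with h | h
    · exact Or.inl h
    · exact Or.inr ⟨h, Fin.lt_def.2 (by simp only; omega)⟩
  · intro z hz
    obtain ⟨a, ha, h⟩ := exists_threshold
      (P := fun i => z (Tuple.sort f i) = v (Tuple.sort f i) + 1) (by
        intro i j hij hi
        rcases hij.eq_or_lt with rfl | hij
        · exact hi
        change z _ = _ at hi
        by_contra hj
        change ¬ z _ = _ at hj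
        have h1 : f (Tuple.sort f i) < f (Tuple.sort f j) := hmono hij
        -- If `z` raises the earlier coordinate but not the later one, every `y` raising the later
        -- one lies above `z` and raises both. So the earlier one has the strictly larger count,
        -- contrary to the sorting.
        have h2 : cnt (Tuple.sort f j) < cnt (Tuple.sort f i) := by
          refine Finset.card_lt_card ⟨?_, ?_⟩
          · intro y hy
            obtain ⟨hy, hyj⟩ := Finset.mem_filter.1 hy
            refine Finset.mem_filter.2 ⟨hy, ?_⟩
            have h3 := (hs z hz).2.2 (Tuple.sort f j)
            have h4 := (hs y hy).2.2 (Tuple.sort f i)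
            simp only [Pi.add_apply, Pi.one_apply] at h3 h4
            rcases hc y hy z hz with h5 | h5
            · have : y (Tuple.sort f j) ≤ z (Tuple.sort f j) := h5 _
              omega
            · have : z (Tuple.sort f i) ≤ y (Tuple.sort f i) := h5 _
              omega
          · intro h3
            exact hj (Finset.mem_filter.1 (h3 (Finset.mem_filter.2 ⟨hz, hi⟩))).2
        rw [Prod.Lex.toLex_lt_toLex] at h1
        simp only at h1
        omega)
    refine Finset.mem_image.2 ⟨a, Finset.mem_range.2 (Nat.lt_succ_iff.2 ha), ?_⟩
    funext c
    have h1 := h ((Tuple.sort f).symm c)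
    simp only [Equiv.apply_symm_apply] at h1
    have h2 : v c ≤ z c := (hs z hz).2.1 c
    have h3 := (hs z hz).2.2 c
    simp only [Pi.add_apply, Pi.one_apply] at h3
    by_cases hzc : z c = v c + 1
    · rw [if_pos (h1.1 hzc), hzc]
    · rw [if_neg fun ha => hzc (h1.2 ha)]
      omega

/-- Near points are comparable, so a pairwise near set is a chain lying between its least element
and that element plus $\mathbb 1$. Such a chain fits into a facet, hence the complex is flag. -/
theorem mem_edgewise_faces_iff (hq : 1 ≤ q) (s : Finset (Fin (k - 1) → ℤ)) :
    s ∈ (edgewise k q).faces ↔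
      s.Nonempty ∧ (∀ x ∈ s, x ∈ vertices k q) ∧ ∀ x ∈ s, ∀ y ∈ s, Near x y := by
  refine and_congr_right fun hne => ⟨?_, ?_⟩
  · rintro ⟨v, π, h1, h2, h3, h4⟩
    exact ⟨fun x hx => mem_vertices_of_mem_facet h1 h2 h3 (h4 hx),
      fun x hx y hy => near_of_mem_facet (h4 hx) (h4 hy)⟩
  · rintro ⟨hv, hn⟩
    obtain ⟨b, hb⟩ := s.exists_minimal hne
    have hle : ∀ z ∈ s, b ≤ z ∧ z ≤ b + 1 := by
      intro z hz
      rcases hn b hb.1 z hz with h | h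
      · exact h
      · have := hb.2 hz h.1
        exact ⟨this, h.1.trans fun i => by simp⟩
    have hbv := hv b hb.1
    -- The least point itself may have coordinates equal to `q`, and then adding $\mathbb 1$ leaves
    -- the vertex set. Truncating at `q - 1` repairs this, and all points stay below `v + 1` because
    -- their coordinates are at most `q`.
    let v : Fin (k - 1) → ℤ := fun i => min (b i) (q - 1)
    have hvm : Monotone v := fun i j hij => min_le_min_right _ (hbv.1 hij)
    have hz : ∀ z ∈ s, Monotone z ∧ v ≤ z ∧ z ≤ v + 1 := by
      intro z hz
      refine ⟨(hv z hz).1, fun i => (min_le_left _ _).trans ((hle z hz).1 i), fun i => ?_⟩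
      have h1 := ((hv z hz).2 i).2
      have h2 := (hle z hz).2 i
      simp only [v, Pi.add_apply, Pi.one_apply] at h2 ⊢
      omega
    obtain ⟨π, h1, h2⟩ := exists_consistent_perm hz fun y hy z hz =>
      (hn y hy z hz).imp And.left And.left
    refine ⟨v, π, ⟨hvm, fun i => ?_⟩, ⟨fun i j hij => ?_, fun i => ?_⟩, h1, h2⟩
    · have := hbv.2 i
      simp only [v]
      omega
    · exact add_le_add_left (hvm hij) 1
    · have := hbv.2 i
      simp only [v, Pi.add_apply, Pi.one_apply]
      omega

end Faces

/-! ### Up-sets of a disjoint union of chains -/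

section BlockUp

variable {E L : Type*} (β : E → L) (ρ : E → ℤ)

/-- Up-sets with respect to the order by `ρ` in each fibre of `β`. -/
def BlockUp (A : Finset E) : Prop := ∀ e e', β e = β e' → ρ e ≤ ρ e' → e ∈ A → e' ∈ A

variable {β ρ} in
theorem blockUp_univ [Fintype E] : BlockUp β ρ Finset.univ := fun _ e' _ _ _ => Finset.mem_univ e'

variable {β ρ} in
theorem blockUp_empty : BlockUp β ρ ∅ := fun _ _ _ _ h => absurd h (Finset.notMem_empty _)

variable [Fintype E] [DecidableEq L]

/-- The size of a fibre. -/
def blockSize (l : L) : ℕ := (Finset.univ.filter fun e => β e = l).card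

/-- The sizes of the parts of a set in the fibres. -/
def blockCount (A : Finset E) : Chains (blockSize β) := fun l =>
  ⟨(A.filter fun e => β e = l).card,
    Nat.lt_succ_iff.2 (Finset.card_le_card (Finset.filter_subset_filter _ A.subset_univ))⟩

variable {β ρ}

/-- Within a block the up-sets are nested, so their sizes decide inclusion. -/
theorem blockCount_le_iff {A A' : Finset E} (hA : BlockUp β ρ A) (hA' : BlockUp β ρ A') :
    blockCount β A ≤ blockCount β A' ↔ A ⊆ A' := by
  constructor
  · intro h e he
    by_contra hne
    have h1 : (A.filter fun e' => β e' = β e).card ≤ (A'.filter fun e' => β e' = β e).card :=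
      h (β e)
    refine absurd h1 (not_le.2 (Finset.card_lt_card ⟨?_, ?_⟩))
    · intro e' he'
      obtain ⟨h2, h3⟩ := Finset.mem_filter.1 he'
      refine Finset.mem_filter.2 ⟨?_, h3⟩
      rcases le_total (ρ e) (ρ e') with h4 | h4
      · exact hA e e' h3.symm h4 he
      · exact absurd (hA' e' e h3 h4 h2) hne
    · intro h2
      exact hne (Finset.mem_filter.1 (h2 (Finset.mem_filter.2 ⟨he, rfl⟩))).1
  · intro h l
    exact Finset.card_le_card (Finset.filter_subset_filter _ h)

theorem exists_blockCount_eq (hρ : ∀ e e', β e = β e' → ρ e = ρ e' → e = e')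
    (y : Chains (blockSize β)) : ∃ A, BlockUp β ρ A ∧ blockCount β A = y := by
  -- The number of larger elements in the same block enumerates each block from the top by
  -- $0,1,2,\ldots$; the desired up-set takes the first `y l` elements of block `l`.
  let r : E → ℕ := fun e => (Finset.univ.filter fun e' => β e' = β e ∧ ρ e < ρ e').card
  have hr : ∀ e e', β e = β e' → (r e' < r e ↔ ρ e < ρ e') := by
    intro e e' hb
    have hmono : ∀ e e', β e = β e' → ρ e ≤ ρ e' → r e' ≤ r e := by
      intro e e' hb hle
      refine Finset.card_le_card fun e'' h => ?_
      simp only [Finset.mem_filter, Finset.mem_univ, true_and] at h ⊢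
      exact ⟨h.1.trans hb.symm, hle.trans_lt h.2⟩
    constructor
    · intro h
      by_contra hle
      exact absurd (hmono e' e hb.symm (not_lt.1 hle)) (not_le.2 h)
    · intro h
      refine Finset.card_lt_card ⟨fun e'' h' => ?_, fun h' => ?_⟩
      · simp only [Finset.mem_filter, Finset.mem_univ, true_and] at h' ⊢
        exact ⟨h'.1.trans hb.symm, h.trans h'.2⟩
      · have := h' (Finset.mem_filter.2 ⟨Finset.mem_univ e', hb.symm, h⟩)
        simp at this
  have hrank : ∀ l, (Finset.univ.filter fun e => β e = l).image r =
      Finset.range (blockSize β l) := by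
    intro l
    refine Finset.eq_of_subset_of_card_le ?_ ?_
    · intro a ha
      obtain ⟨e, he, rfl⟩ := Finset.mem_image.1 ha
      obtain rfl := (Finset.mem_filter.1 he).2
      refine Finset.mem_range.2 (Finset.card_lt_card ⟨fun e' h' => ?_, fun h' => ?_⟩)
      · simp only [Finset.mem_filter, Finset.mem_univ, true_and] at h' ⊢
        exact h'.1
      · have := h' he
        simp at this
    · rw [Finset.card_range, Finset.card_image_of_injOn]
      · rfl
      · intro e he e' he' h
        have h1 : β e = β e' := (Finset.mem_filter.1 he).2.trans (Finset.mem_filter.1 he').2.symm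
        refine hρ e e' h1 (le_antisymm ?_ ?_)
        · exact not_lt.1 fun hlt => ((hr e' e h1.symm).2 hlt).ne h
        · exact not_lt.1 fun hlt => ((hr e e' h1).2 hlt).ne' h
  refine ⟨Finset.univ.filter fun e => r e < y (β e), ?_, ?_⟩
  · intro e e' hb hle he
    simp only [Finset.mem_filter, Finset.mem_univ, true_and] at he ⊢
    rw [← hb]
    refine lt_of_le_of_lt (not_lt.1 fun h => ?_) he
    exact absurd ((hr e' e hb.symm).1 h) (not_lt.2 hle)
  · funext l
    refine Fin.ext ?_
    change ((Finset.univ.filter fun e => r e < y (β e)).filter fun e => β e = l).card = y l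
    have h1 : ((Finset.univ.filter fun e => r e < y (β e)).filter fun e => β e = l).image r =
        Finset.range (y l) := by
      ext a
      constructor
      · intro ha
        obtain ⟨e, he, rfl⟩ := Finset.mem_image.1 ha
        obtain ⟨h2, rfl⟩ := Finset.mem_filter.1 he
        exact Finset.mem_range.2 (Finset.mem_filter.1 h2).2
      · intro ha
        have ha' := Finset.mem_range.1 ha
        have h2 : a ∈ Finset.range (blockSize β l) :=
          Finset.mem_range.2 (ha'.trans_le (Nat.lt_succ_iff.1 (y l).2))
        rw [← hrank] at h2
        obtain ⟨e, he, rfl⟩ := Finset.mem_image.1 h2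
        obtain rfl := (Finset.mem_filter.1 he).2
        exact Finset.mem_image_of_mem r (by simpa using ha')
    rw [← Finset.card_range (y l), ← h1, Finset.card_image_of_injOn]
    intro e he e' he' h
    have h1 : β e = β e' := (Finset.mem_filter.1 he).2.trans (Finset.mem_filter.1 he').2.symm
    refine hρ e e' h1 (le_antisymm ?_ ?_)
    · exact not_lt.1 fun hlt => ((hr e' e h1.symm).2 hlt).ne h
    · exact not_lt.1 fun hlt => ((hr e e' h1).2 hlt).ne' h

theorem blockCount_empty : blockCount β (∅ : Finset E) = ⊥ := by
  funext l
  refine Fin.ext ?_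
  change ((∅ : Finset E).filter fun e => β e = l).card = 0
  simp

theorem blockCount_univ : blockCount β (Finset.univ : Finset E) = ⊤ := rfl

theorem blockCount_injOn {A A' : Finset E} (hA : BlockUp β ρ A) (hA' : BlockUp β ρ A')
    (h : blockCount β A = blockCount β A') : A = A' :=
  ((blockCount_le_iff hA hA').1 h.le).antisymm ((blockCount_le_iff hA' hA).1 h.ge)

/-- The proper up-sets of a disjoint union of chains. -/
noncomputable def blockEquiv (hρ : ∀ e e', β e = β e' → ρ e = ρ e' → e = e') :
    {A // BlockUp β ρ A ∧ A ≠ Finset.univ} ≃ {y : Chains (blockSize β) // y ≠ ⊤} := by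
  refine Equiv.ofBijective (fun A => ⟨blockCount β A.1, fun h => A.2.2 ?_⟩) ⟨?_, ?_⟩
  · exact blockCount_injOn A.2.1 blockUp_univ (h.trans blockCount_univ.symm)
  · intro A A' h
    exact Subtype.ext (blockCount_injOn A.2.1 A'.2.1 (congrArg Subtype.val h))
  · rintro ⟨y, hy⟩
    obtain ⟨A, hA, rfl⟩ := exists_blockCount_eq hρ y
    refine ⟨⟨A, hA, ?_⟩, rfl⟩
    rintro rfl
    exact hy blockCount_univ

end BlockUp

/-! ### The star of a vertex -/

section Star

variable {n : ℕ}

/-- Monotone lifts of the vertices of the edgewise subdivision. -/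
def IsLift (q : ℕ) (u : Fin (n + 1) → ℤ) : Prop := Monotone u ∧ u (Fin.last n) ≤ u 0 + q

/-- The vertex represented by a lift. -/
def proj (u : Fin (n + 1) → ℤ) : Fin n → ℤ := fun i => u i.succ - u 0

/-- Increase the coordinates in `A`. -/
def raise (x : Fin (n + 1) → ℤ) (A : Finset (Fin (n + 1))) : Fin (n + 1) → ℤ :=
  fun i => x i + if i ∈ A then 1 else 0

theorem isLift_iff {q : ℕ} {u : Fin (n + 1) → ℤ} :
    IsLift q u ↔ Monotone (proj u) ∧ ∀ i, 0 ≤ proj u i ∧ proj u i ≤ q := by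
  constructor
  · rintro ⟨h1, h2⟩
    refine ⟨fun i j hij => ?_, fun i => ?_⟩
    · have : u i.succ ≤ u j.succ := h1 (Fin.succ_le_succ_iff.2 hij)
      simp only [proj]
      omega
    · have h3 : u 0 ≤ u i.succ := h1 (Fin.zero_le _)
      have h4 : u i.succ ≤ u (Fin.last n) := h1 (Fin.le_last _)
      simp only [proj]
      omega
  · rintro ⟨h1, h2⟩
    simp only [proj] at h2
    refine ⟨fun i j hij => ?_, ?_⟩
    · induction j using Fin.cases with
      | zero => rw [Fin.le_zero_iff.1 hij]
      | succ j =>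
        induction i using Fin.cases with
        | zero =>
          have := h2 j
          omega
        | succ i =>
          have : u i.succ - u 0 ≤ u j.succ - u 0 := h1 (Fin.succ_le_succ_iff.1 hij)
          omega
    · generalize Fin.last n = l
      induction l using Fin.cases with
      | zero => omega
      | succ l =>
        have := h2 l
        omega

variable {q : ℕ}

/-- The residue of a coordinate. -/
def label (q : ℕ) (x : Fin (n + 1) → ℤ) (i : Fin (n + 1)) : ZMod q := (x i : ZMod q)

/-- The order in which coordinates of equal residue have to be increased. -/
def position (q : ℕ) (x : Fin (n + 1) → ℤ) (i : Fin (n + 1)) : ℤ :=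
  -- Continue `x` periodically by $x_{i+n+1}=x_i+q$. A coordinate with value $x_0+q$ is then a copy
  -- of one with value $x_0$ at index $i-(n+1)$, which precedes all genuine indices.
  if x i = x 0 + q then (i : ℤ) - (n + 1) else i

/-- All values lie in a window of length `q`, so different values can agree mod `q` only at its two
ends. -/
theorem label_eq_iff {x : Fin (n + 1) → ℤ} (hx : IsLift q x) (i j : Fin (n + 1)) :
    label q x i = label q x j ↔ x i = x j ∨ (x i = x 0 ∧ x j = x 0 + q) ∨
      (x j = x 0 ∧ x i = x 0 + q) := by
  have hb : ∀ i, x 0 ≤ x i ∧ x i ≤ x 0 + q := fun i =>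
    ⟨hx.1 (Fin.zero_le _), (hx.1 (Fin.le_last _)).trans hx.2⟩
  have hi := hb i
  have hj := hb j
  rw [label, label, ZMod.intCast_eq_intCast_iff_dvd_sub]
  constructor
  · intro h
    by_cases h0 : x j - x i = 0
    · left
      omega
    · rcases lt_or_gt_of_ne h0 with h1 | h1
      · have := Int.le_of_dvd (by omega) ((dvd_neg (a := (q : ℤ))).2 h)
        omega
      · have := Int.le_of_dvd h1 h
        omega
  · rintro (h | ⟨h1, h2⟩ | ⟨h1, h2⟩)
    · rw [h, sub_self]
      exact dvd_zero _
    · exact ⟨1, by omega⟩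
    · exact ⟨-1, by omega⟩

theorem position_injective {x : Fin (n + 1) → ℤ} (i j : Fin (n + 1))
    (h : position q x i = position q x j) : i = j := by
  refine Fin.ext ?_
  have := i.2
  have := j.2
  simp only [position] at h
  split_ifs at h <;> omega

/-- Raising by one can violate an inequality only where it was an equality: between equal
coordinates, or between the last and the first coordinate when they differ by `q`. These are the
constraints inside the residue classes. -/
theorem isLift_raise_iff [NeZero q] {x : Fin (n + 1) → ℤ} (hx : IsLift q x)
    (A : Finset (Fin (n + 1))) : IsLift q (raise x A) ↔ BlockUp (label q x) (position q x) A := by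
  have hq : 1 ≤ q := NeZero.one_le
  have hb : ∀ i, x 0 ≤ x i ∧ x i ≤ x 0 + q := fun i =>
    ⟨hx.1 (Fin.zero_le _), (hx.1 (Fin.le_last _)).trans hx.2⟩
  constructor
  · rintro ⟨h1, h2⟩ i j hl hp hi
    have hi2 := i.2
    have hj2 := j.2
    by_contra hj
    rw [label_eq_iff hx] at hl
    simp only [position] at hp
    -- The case $x_i=x_0$, $x_j=x_0+q$ is excluded, since there `position` is negative at `j` and
    -- nonnegative at `i`.
    have hcase : x i = x j ∧ i ≤ j ∨ x j = x 0 ∧ x i = x 0 + q := by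
      rcases hl with h | h | h
      · left
        refine ⟨h, Fin.le_def.2 ?_⟩
        rw [h] at hp
        split_ifs at hp <;> omega
      · rw [if_neg (by omega), if_pos h.2] at hp
        omega
      · exact Or.inr h
    rcases hcase with ⟨h, hij⟩ | ⟨h, h'⟩
    · have h3 := h1 hij
      simp only [raise, if_pos hi, if_neg hj] at h3
      omega
    · have h3 := h1 (Fin.le_last i)
      have h4 := h1 (Fin.zero_le j)
      have h5 : raise x A i = x i + 1 := by simp [raise, hi]
      have h6 : raise x A j = x j := by simp [raise, hj]
      omega
  · intro h
    have hadj : ∀ i, x i ≤ raise x A i ∧ raise x A i ≤ x i + 1 := by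
      intro i
      simp only [raise]
      split_ifs <;> omega
    have hraise : ∀ i j, (i ∈ A → j ∈ A) → raise x A i - x i ≤ raise x A j - x j := by
      intro i j hij
      simp only [raise]
      by_cases hi : i ∈ A
      · simp [hi, hij hi]
      · simp only [hi, if_false]
        split_ifs <;> omega
    refine ⟨fun i j hij => ?_, ?_⟩
    · rcases (hx.1 hij).lt_or_eq with h1 | h1
      · have := hadj i
        have := hadj j
        omega
      · have := hraise i j (h i j ((label_eq_iff hx i j).2 (Or.inl h1)) (by
          have : (i : ℕ) ≤ j := hij
          simp only [position, h1]
          split_ifs <;> omega))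
        omega
    · have h0 := hadj 0
      have hl := hadj (Fin.last n)
      rcases hx.2.lt_or_eq with h1 | h1
      · omega
      · have := hraise (Fin.last n) 0 (h _ _ ((label_eq_iff hx _ _).2 (Or.inr (Or.inr ⟨rfl, h1⟩)))
          (by
            simp only [position, if_pos h1]
            rw [if_neg (by omega)]
            simp))
        omega

end Star

/-! ### Nearness after projection as nestedness of the raised sets. -/

section Star

variable {n q : ℕ} {x : Fin (n + 1) → ℤ} {A A' : Finset (Fin (n + 1))}

theorem proj_raise (x : Fin (n + 1) → ℤ) (A : Finset (Fin (n + 1))) (i : Fin n) :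
    proj (raise x A) i = proj x i + (if i.succ ∈ A then 1 else 0) - if 0 ∈ A then 1 else 0 := by
  simp only [proj, raise]
  ring

theorem subset_iff_succ : A ⊆ A' ↔ (0 ∈ A → 0 ∈ A') ∧ ∀ i : Fin n, i.succ ∈ A → i.succ ∈ A' :=
  Fin.forall_fin_succ (P := fun i => i ∈ A → i ∈ A')

theorem eq_univ_iff_succ : A = Finset.univ ↔ 0 ∈ A ∧ ∀ i : Fin n, i.succ ∈ A := by
  rw [Finset.eq_univ_iff_forall]
  exact Fin.forall_fin_succ

/-- Raising coordinate `0` lowers the whole projection by one, so membership of `0` decides the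
direction of inclusion. If `0` lies in `A'` only, the first inequality forces every other coordinate
into `A'`, which properness forbids. -/
theorem subset_or_subset_of_le (hA' : A' ≠ Finset.univ)
    (h1 : proj (raise x A) ≤ proj (raise x A')) (h2 : proj (raise x A') ≤ proj (raise x A) + 1) :
    A ⊆ A' ∨ A' ⊆ A := by
  have h1 : ∀ i, proj (raise x A) i ≤ proj (raise x A') i := h1
  have h2 : ∀ i, proj (raise x A') i ≤ proj (raise x A) i + 1 := h2
  simp only [proj_raise] at h1 h2
  by_cases h : 0 ∈ A' ∧ 0 ∉ A
  · refine absurd (eq_univ_iff_succ.2 ⟨h.1, fun i => ?_⟩) hA'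
    have := h1 i
    rw [if_pos h.1, if_neg h.2] at this
    split_ifs at this with h3 h4 <;> first | assumption | omega
  · by_cases h' : 0 ∈ A ∧ 0 ∉ A'
    · refine Or.inr (subset_iff_succ.2 ⟨fun _ => h'.1, fun i hi => ?_⟩)
      have := h2 i
      rw [if_pos h'.1, if_neg h'.2, if_pos hi] at this
      split_ifs at this with h3 <;> first | assumption | omega
    · refine Or.inl (subset_iff_succ.2 ⟨by tauto, fun i hi => ?_⟩)
      have h0 : 0 ∈ A ↔ 0 ∈ A' := by tauto
      have := h1 i
      rw [if_pos hi] at this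
      simp only [h0] at this
      split_ifs at this with h3 <;> first | assumption | omega

/-- If `0` is in both sets or in neither, the larger set projects to the larger point; if only `A'`
contains it, the order of the projections is reversed. -/
theorem near_of_subset (h : A ⊆ A') : Near (proj (raise x A)) (proj (raise x A')) := by
  have hs : ∀ i, (if i ∈ A then (1 : ℤ) else 0) ≤ if i ∈ A' then 1 else 0 := by
    intro i
    by_cases hi : i ∈ A
    · rw [if_pos hi, if_pos (h hi)]
    · rw [if_neg hi]
      split_ifs <;> omega
  have hb : ∀ (B : Finset (Fin (n + 1))) i, 0 ≤ (if i ∈ B then (1 : ℤ) else 0) ∧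
      (if i ∈ B then (1 : ℤ) else 0) ≤ 1 := by
    intro B i
    split_ifs <;> omega
  by_cases h0 : 0 ∈ A' ∧ 0 ∉ A
  · refine Or.inr ⟨fun i => ?_, fun i => ?_⟩ <;>
      simp only [proj_raise, Pi.add_apply, Pi.one_apply, if_pos h0.1, if_neg h0.2] <;>
      have h1 := hs i.succ <;> have h2 := hb A i.succ <;> have h3 := hb A' i.succ <;> omega
  · have h0 : 0 ∈ A ↔ 0 ∈ A' := ⟨fun h1 => h h1, fun h1 => by tauto⟩
    refine Or.inl ⟨fun i => ?_, fun i => ?_⟩ <;>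
      simp only [proj_raise, Pi.add_apply, Pi.one_apply, h0] <;>
      have h1 := hs i.succ <;> have h2 := hb A i.succ <;> have h3 := hb A' i.succ <;> omega

theorem near_proj_raise_iff (hA : A ≠ Finset.univ) (hA' : A' ≠ Finset.univ) :
    Near (proj (raise x A)) (proj (raise x A')) ↔ A ⊆ A' ∨ A' ⊆ A := by
  constructor
  · rintro (⟨h1, h2⟩ | ⟨h1, h2⟩)
    · exact subset_or_subset_of_le hA' h1 h2
    · exact (subset_or_subset_of_le hA h1 h2).symm
  · rintro (h | h)
    · exact near_of_subset h
    · exact (near_of_subset h).symm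

theorem raise_empty : raise x ∅ = x := by
  funext i
  simp [raise]

theorem proj_raise_injOn (hA : A ≠ Finset.univ) (hA' : A' ≠ Finset.univ)
    (h : proj (raise x A) = proj (raise x A')) : A = A' := by
  have key : ∀ A A' : Finset (Fin (n + 1)), A' ≠ Finset.univ → A ⊆ A' →
      proj (raise x A) = proj (raise x A') → A = A' := by
    intro A A' hA' hs h
    have h1 := fun i => congrFun h i
    simp only [proj_raise] at h1
    by_cases h0 : 0 ∈ A' ∧ 0 ∉ A
    · refine absurd (eq_univ_iff_succ.2 ⟨h0.1, fun i => ?_⟩) hA'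
      have := h1 i
      rw [if_pos h0.1, if_neg h0.2] at this
      split_ifs at this with h3 h4 <;> first | assumption | omega
    · refine hs.antisymm (subset_iff_succ.2 ⟨by tauto, fun i hi => ?_⟩)
      have h2 : 0 ∈ A ↔ 0 ∈ A' := ⟨fun h => hs h, fun h => by tauto⟩
      have := h1 i
      rw [if_pos hi] at this
      simp only [h2] at this
      split_ifs at this with h3 <;> first | assumption | omega
  rcases (near_proj_raise_iff (x := x) hA hA').1 (h ▸ Near.refl _) with hs | hs
  · exact key A A' hA' hs h
  · exact (key A' A hA hs h.symm).symm

/-- To go up, raise the increased coordinates and not `0`. To go down, raise `0` together with all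
coordinates that are to stay fixed. -/
theorem exists_proj_raise_eq {z : Fin n → ℤ} (hz : Near (proj x) z) :
    ∃ A, A ≠ Finset.univ ∧ proj (raise x A) = z := by
  classical
  by_cases h : proj x ≤ z
  · refine ⟨Finset.univ.filter fun i => ∃ j : Fin n, i = j.succ ∧ z j = proj x j + 1, ?_, ?_⟩
    · intro hA
      have := (eq_univ_iff_succ.1 hA).1
      simp only [Finset.mem_filter, Finset.mem_univ, true_and] at this
      obtain ⟨j, hj, -⟩ := this
      exact (Fin.succ_ne_zero j).symm hj
    · funext i
      have h1 : proj x i ≤ z i := h i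
      have h2 : z i ≤ proj x i + 1 := by
        rcases hz with hz | hz
        · exact hz.2 i
        · have : z i ≤ proj x i := hz.1 i
          omega
      have h3 : ¬ ∃ j : Fin n, 0 = j.succ ∧ z j = proj x j + 1 :=
        fun ⟨j, hj, _⟩ => (Fin.succ_ne_zero j).symm hj
      simp only [proj_raise, Finset.mem_filter, Finset.mem_univ, true_and, Fin.succ_inj,
        exists_eq_left', h3, if_false]
      split_ifs <;> omega
  · have hz' : z ≤ proj x ∧ proj x ≤ z + 1 := hz.resolve_left fun h' => h h'.1
    refine ⟨Finset.univ.filter fun i => ∀ j : Fin n, i = j.succ → z j = proj x j, ?_, ?_⟩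
    · intro hA
      refine h fun i => ?_
      have := (eq_univ_iff_succ.1 hA).2 i
      simp only [Finset.mem_filter, Finset.mem_univ, true_and] at this
      exact (this i rfl).ge
    · funext i
      have h1 : z i ≤ proj x i := hz'.1 i
      have h2 : proj x i ≤ z i + 1 := hz'.2 i
      have h3 : ∀ j : Fin n, 0 = j.succ → z j = proj x j :=
        fun j hj => absurd hj (Fin.succ_ne_zero j).symm
      have h4 : (∀ j : Fin n, i.succ = j.succ → z j = proj x j) ↔ z i = proj x i :=
        ⟨fun h => h i rfl, fun h j hj => Fin.succ_inj.1 hj ▸ h⟩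
      rw [proj_raise]
      simp only [Finset.mem_filter, Finset.mem_univ, true_and, h4]
      rw [if_pos h3]
      split_ifs <;> omega

end Star

/-- The vertices near a vertex form a product of chains without its maximum. -/
theorem exists_star_equiv {k q : ℕ} [NeZero q] {x : Fin (k - 1 + 1) → ℤ} (hx : IsLift q x) :
    ∃ φ : {y : Chains (blockSize (label q x)) // y ≠ ⊤} ≃
        {z // z ∈ vertices k q ∧ Near (proj x) z},
      (∀ y, y.1 = ⊥ → (φ y).1 = proj x) ∧
      ∀ y y', Comp y.1 y'.1 ↔ Near (φ y).1 (φ y').1 := by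
  let e := blockEquiv (β := label q x) (ρ := position q x) fun i j _ h => position_injective i j h
  have hv : ∀ A, proj (raise x A) ∈ vertices k q ↔ BlockUp (label q x) (position q x) A :=
    fun A => isLift_iff.symm.trans (isLift_raise_iff hx A)
  have hb : ∀ A : Finset (Fin (k - 1 + 1)), Near (proj x) (proj (raise x A)) := fun A => by
    have := near_of_subset (x := x) (Finset.empty_subset A)
    rwa [raise_empty] at this
  let f : {A // BlockUp (label q x) (position q x) A ∧ A ≠ Finset.univ} ≃
      {z // z ∈ vertices k q ∧ Near (proj x) z} := by
    refine Equiv.ofBijective (fun A => ⟨proj (raise x A.1), (hv A.1).2 A.2.1, hb A.1⟩) ⟨?_, ?_⟩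
    · intro A A' h
      exact Subtype.ext (proj_raise_injOn A.2.2 A'.2.2 (congrArg Subtype.val h))
    · rintro ⟨z, hz, hn⟩
      obtain ⟨A, hA, rfl⟩ := exists_proj_raise_eq hn
      exact ⟨⟨A, (hv A).1 hz, hA⟩, rfl⟩
  have hf : ∀ A, (f A).1 = proj (raise x A.1) := fun A => rfl
  refine ⟨e.symm.trans f, ?_, ?_⟩
  · intro y hy
    obtain ⟨A, rfl⟩ := e.surjective y
    have hA : A.1 = ∅ := blockCount_injOn A.2.1 blockUp_empty (hy.trans blockCount_empty.symm)
    rw [Equiv.trans_apply, e.symm_apply_apply, hf, hA, raise_empty]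
  · intro y y'
    obtain ⟨A, rfl⟩ := e.surjective y
    obtain ⟨A', rfl⟩ := e.surjective y'
    rw [Equiv.trans_apply, Equiv.trans_apply, e.symm_apply_apply, e.symm_apply_apply, hf, hf,
      near_proj_raise_iff A.2.2 A'.2.2]
    exact or_congr (blockCount_le_iff A.2.1 A'.2.1) (blockCount_le_iff A'.2.1 A.2.1)

theorem sum_blockSize {n : ℕ} (q : ℕ) [NeZero q] (x : Fin (n + 1) → ℤ) :
    ∑ l, blockSize (label q x) l = n + 1 := by
  have := Finset.card_eq_sum_card_fiberwise (f := label q x) (s := Finset.univ)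
    (t := Finset.univ) fun _ _ => Finset.mem_coe.2 (Finset.mem_univ _)
  simpa [blockSize] using this.symm

/-- Every vertex has a lift. -/
theorem exists_isLift {k q : ℕ} {b : Fin (k - 1) → ℤ} (hb : b ∈ vertices k q) :
    ∃ x : Fin (k - 1 + 1) → ℤ, IsLift q x ∧ proj x = b := by
  have h : proj (Fin.cons 0 b : Fin (k - 1 + 1) → ℤ) = b := by
    funext i
    simp [proj]
  refine ⟨Fin.cons 0 b, isLift_iff.2 ?_, h⟩
  rw [h]
  exact hb

/-- Every sequence of block sizes is realized. -/
theorem exists_isLift_blockSize_eq {n q : ℕ} [NeZero q] (d : ZMod q → ℕ) (hd : ∑ l, d l = n + 1) :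
    ∃ x : Fin (n + 1) → ℤ, IsLift q x ∧ blockSize (label q x) = d := by
  have hcard : Fintype.card (Fin (n + 1)) = Fintype.card (Σ l, Fin (d l)) := by
    simp [hd]
  let e := Fintype.equivOfCardEq hcard
  -- Representatives of the residues in $0,\ldots,q-1$, once sorted, form a lift, since they span
  -- less than `q`.
  let g : Fin (n + 1) → ℕ := fun i => (e i).1.val
  let π := Tuple.sort g
  refine ⟨fun i => (g (π i) : ℤ), ⟨fun i j hij => ?_, ?_⟩, ?_⟩
  · exact Int.ofNat_le.2 (Tuple.monotone_sort g hij)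
  · have := ZMod.val_lt (e (π (Fin.last n))).1
    simp only [g]
    omega
  · funext l
    have h : ∀ i, label q (fun i => (g (π i) : ℤ)) i = (e (π i)).1 := fun i => by
      simp [label, g]
    rw [blockSize, ← Fintype.card_subtype]
    simp only [h]
    let f : {i // (e (π i)).1 = l} ≃ Fin (d l) :=
      ((π.trans e).subtypeEquiv fun i => Iff.rfl).trans (Equiv.sigmaSubtype l)
    rw [Fintype.card_congr f, Fintype.card_fin]

/-! ### Links -/

section Link

variable {k q m : ℕ} {ι : Type*} {d : ι → ℕ} {b : Fin (k - 1) → ℤ}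
  (φ : {y : Chains d // y ≠ ⊤} ≃ {z // z ∈ vertices k q ∧ Near b z})
  {c : Fin (m + 2) → Chains d}

theorem ne_top_of_chain (hc : StrictMono c) (j : Fin (m + 1)) : c j.castSucc ≠ ⊤ :=
  fun h => not_top_lt (h ▸ hc j.castSucc_lt_succ)

/-- The face of the edgewise subdivision that corresponds to a chain. -/
def chainFace (hc : StrictMono c) : Finset (Fin (k - 1) → ℤ) :=
  Finset.univ.image fun j : Fin (m + 1) => (φ ⟨c j.castSucc, ne_top_of_chain hc j⟩).1

theorem mem_chainFace_iff (hc : StrictMono c) (y : {y : Chains d // y ≠ ⊤}) :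
    (φ y).1 ∈ chainFace φ hc ↔ ∃ j : Fin (m + 1), c j.castSucc = y.1 := by
  simp only [chainFace, Finset.mem_image, Finset.mem_univ, true_and]
  refine exists_congr fun j => ?_
  rw [Subtype.val_injective.eq_iff, φ.apply_eq_iff_eq, Subtype.ext_iff]

theorem card_chainFace (hc : StrictMono c) : (chainFace φ hc).card = m + 1 := by
  rw [chainFace, Finset.card_image_of_injective, Finset.card_univ, Fintype.card_fin]
  intro i j h
  have h1 := congrArg Subtype.val (φ.injective (Subtype.val_injective h))
  exact Fin.castSucc_injective _ (hc.injective h1)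

variable {φ}

theorem mem_faces_of_comp (hq : 1 ≤ q)
    (hφ : ∀ y y', Comp y.1 y'.1 ↔ Near (φ y).1 (φ y').1)
    {s : Finset (Fin (k - 1) → ℤ)} (hs : s.Nonempty)
    (h1 : ∀ z ∈ s, ∃ y, (φ y).1 = z)
    (h2 : ∀ y y', (φ y).1 ∈ s → (φ y').1 ∈ s → Comp y.1 y'.1) : s ∈ (edgewise k q).faces := by
  refine (mem_edgewise_faces_iff hq s).2 ⟨hs, fun z hz => ?_, fun z hz w hw => ?_⟩
  · obtain ⟨y, rfl⟩ := h1 z hz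
    exact (φ y).2.1
  · obtain ⟨y, rfl⟩ := h1 z hz
    obtain ⟨y', rfl⟩ := h1 w hw
    exact (hφ _ _).1 (h2 y y' hz hw)

theorem exists_of_mem_chainFace (hc : StrictMono c) {z : Fin (k - 1) → ℤ}
    (hz : z ∈ chainFace φ hc) : ∃ y, (φ y).1 = z := by
  obtain ⟨j, -, rfl⟩ := Finset.mem_image.1 hz
  exact ⟨_, rfl⟩

theorem comp_chain (hc : StrictMono c) (i j : Fin (m + 2)) : Comp (c i) (c j) :=
  (le_total i j).imp (fun h => hc.monotone h) fun h => hc.monotone h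

theorem chainFace_mem_faces (hq : 1 ≤ q)
    (hφ : ∀ y y', Comp y.1 y'.1 ↔ Near (φ y).1 (φ y').1)
    (hc : StrictMono c) : chainFace φ hc ∈ (edgewise k q).faces := by
  refine mem_faces_of_comp hq hφ ?_ (fun z => exists_of_mem_chainFace hc) ?_
  · rw [← Finset.card_pos, card_chainFace]
    omega
  · intro y y' hy hy'
    obtain ⟨i, hi⟩ := (mem_chainFace_iff φ hc y).1 hy
    obtain ⟨j, hj⟩ := (mem_chainFace_iff φ hc y').1 hy'
    rw [← hi, ← hj]
    exact comp_chain hc _ _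

/-- The condition at the last element `⊤` of the chain only says `y ≠ ⊤`; at the others it expresses
nearness to the vertices of the face and disjointness from it. -/
theorem isFlagOf_link (hq : 1 ≤ q)
    (hφ : ∀ y y', Comp y.1 y'.1 ↔ Near (φ y).1 (φ y').1)
    (hb : ∀ y, y.1 = ⊥ → (φ y).1 = b) (hc : StrictMono c) (h0 : c 0 = ⊥)
    (h1 : c (Fin.last _) = ⊤) :
    IsFlagOf (link (edgewise k q) (chainFace φ hc))
      (fun u v : {y // ∀ j, Comp y (c j) ∧ y ≠ c j} => Comp u.1 v.1)
      (fun y => (φ ⟨y.1, h1 ▸ (y.2 (Fin.last _)).2⟩).1) where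
  refl y := Comp.refl _
  symm y z h := h.symm
  inj y z h := by
    have h2 := congrArg Subtype.val (φ.injective (Subtype.val_injective h))
    exact Subtype.ext h2
  mem_faces τ := by
    have hbmem : b ∈ chainFace φ hc := by
      have h2 := hb ⟨c 0, ne_top_of_chain hc 0⟩ h0
      have h3 := (mem_chainFace_iff φ hc ⟨c 0, ne_top_of_chain hc 0⟩).2 ⟨0, rfl⟩
      rwa [h2] at h3
    constructor
    · rintro ⟨hτ, hu, hdisj⟩
      rw [mem_edgewise_faces_iff hq] at hτ hu
      refine ⟨hτ.1, fun z hz => ?_, fun y y' hy hy' => (hφ _ _).2 (hτ.2.2 _ hy _ hy')⟩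
      -- As `b` belongs to the face, every vertex of the link is near `b` and so within the range of
      -- `φ`.
      have hzb : Near b z := hu.2.2 _ (Finset.mem_union_left _ hbmem) _
        (Finset.mem_union_right _ hz)
      obtain ⟨y, hy⟩ := φ.surjective ⟨z, hτ.2.1 z hz, hzb⟩
      have hyz : (φ y).1 = z := congrArg Subtype.val hy
      refine ⟨⟨y.1, fun j => ?_⟩, hyz⟩
      induction j using Fin.lastCases with
      | last =>
        rw [h1]
        exact ⟨Or.inl le_top, y.2⟩
      | cast j =>
        have hj := (mem_chainFace_iff φ hc ⟨c j.castSucc, ne_top_of_chain hc j⟩).2 ⟨j, rfl⟩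
        constructor
        · refine (hφ y ⟨c j.castSucc, ne_top_of_chain hc j⟩).2 ?_
          rw [hyz]
          exact hu.2.2 _ (Finset.mem_union_right _ hz) _ (Finset.mem_union_left _ hj)
        · intro h
          refine Finset.disjoint_left.1 hdisj ((mem_chainFace_iff φ hc y).2 ⟨j, h.symm⟩) ?_
          rw [hyz]
          exact hz
    · rintro ⟨hne, hr, hcomp⟩
      have hτ : ∀ y, (φ y).1 ∈ τ → ∀ j, Comp y.1 (c j) ∧ y.1 ≠ c j := by
        intro y hy
        obtain ⟨y', hy'⟩ := hr _ hy
        have := congrArg Subtype.val (φ.injective (Subtype.val_injective hy'))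
        rw [← this]
        exact y'.2
      have hcomp' : ∀ y y', (φ y).1 ∈ τ → (φ y').1 ∈ τ → Comp y.1 y'.1 :=
        fun y y' hy hy' => hcomp ⟨y.1, hτ y hy⟩ ⟨y'.1, hτ y' hy'⟩ hy hy'
      have hr' : ∀ z ∈ τ, ∃ y, (φ y).1 = z := fun z hz => by
        obtain ⟨y, rfl⟩ := hr z hz
        exact ⟨_, rfl⟩
      refine ⟨mem_faces_of_comp hq hφ hne hr' hcomp',
        mem_faces_of_comp hq hφ (hne.mono Finset.subset_union_right) ?_ ?_, ?_⟩
      · intro z hz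
        rcases Finset.mem_union.1 hz with hz | hz
        · exact exists_of_mem_chainFace hc hz
        · exact hr' z hz
      · intro y y' hy hy'
        rcases Finset.mem_union.1 hy with hy | hy <;> rcases Finset.mem_union.1 hy' with hy' | hy'
        · obtain ⟨i, hi⟩ := (mem_chainFace_iff φ hc y).1 hy
          obtain ⟨j, hj⟩ := (mem_chainFace_iff φ hc y').1 hy'
          rw [← hi, ← hj]
          exact comp_chain hc _ _
        · obtain ⟨i, hi⟩ := (mem_chainFace_iff φ hc y).1 hy
          rw [← hi]
          exact (hτ y' hy' _).1.symm
        · obtain ⟨j, hj⟩ := (mem_chainFace_iff φ hc y').1 hy'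
          rw [← hj]
          exact (hτ y hy _).1
        · exact hcomp' y y' hy hy'
      · rw [Finset.disjoint_left]
        intro z hz hz'
        obtain ⟨y, rfl⟩ := hr' z hz'
        obtain ⟨j, hj⟩ := (mem_chainFace_iff φ hc y).1 hz
        exact (hτ y hz' _).2 hj.symm

theorem combType_link [Fintype ι] (hq : 1 ≤ q)
    (hφ : ∀ y y', Comp y.1 y'.1 ↔ Near (φ y).1 (φ y').1)
    (hb : ∀ y, y.1 = ⊥ → (φ y).1 = b) (hc : StrictMono c) (h0 : c 0 = ⊥)
    (h1 : c (Fin.last _) = ⊤) :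
    combType (link (edgewise k q) (chainFace φ hc)) = joinType (gapParts c) := by
  refine Quotient.sound (((isFlagOf_link hq hφ hb hc h0 h1).combEquiv_iff
    (isFlagOf_join fun j => ProperPart (gapParts c j))).2 ?_)
  exact exists_gapParts_equiv hc h0 h1

/-- Every face that contains `b` corresponds to a chain. -/
theorem exists_chainFace_eq (hq : 1 ≤ q) (hφ : ∀ y y', Comp y.1 y'.1 ↔ Near (φ y).1 (φ y').1)
    (hb : ∀ y, y.1 = ⊥ → (φ y).1 = b) (hd : (⊥ : Chains d) ≠ ⊤) {σ : Finset (Fin (k - 1) → ℤ)}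
    (hσ : σ ∈ (edgewise k q).faces) (hbσ : b ∈ σ) (hcard : σ.card = m + 1) :
    ∃ (c : Fin (m + 2) → Chains d) (hc : StrictMono c), c 0 = ⊥ ∧ c (Fin.last _) = ⊤ ∧
      chainFace φ hc = σ := by
  obtain ⟨-, hv, hn⟩ := (mem_edgewise_faces_iff hq σ).1 hσ
  let f : σ → Chains d := fun z => (φ.symm ⟨z.1, hv _ z.2, hn _ hbσ _ z.2⟩).1
  have hf : ∀ z, ∃ h, (φ ⟨f z, h⟩).1 = z.1 := fun z => ⟨(φ.symm _).2, by
    simp [f]⟩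
  have hfinj : Function.Injective f := by
    intro z w h
    obtain ⟨h1, h2⟩ := hf z
    obtain ⟨h3, h4⟩ := hf w
    refine Subtype.ext ?_
    rw [← h2, ← h4]
    simp only [h]
  -- No vertex corresponds to `⊤`, so adding it gives `m + 2` distinct, pairwise comparable
  -- elements, to be sorted into the chain.
  let X : Multiset (Chains d) := ⊤ ::ₘ (Finset.univ : Finset σ).val.map f
  have hX : ∀ y, y ∈ X ↔ y = ⊤ ∨ ∃ z, f z = y := by
    intro y
    simp only [X, Multiset.mem_cons, Multiset.mem_map, Finset.mem_val, Finset.mem_univ, true_and]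
  have hXcard : X.card = m + 2 := by
    rw [Multiset.card_cons, Multiset.card_map, Finset.card_val, Finset.card_univ,
      Fintype.card_coe, hcard]
  have hXnodup : X.Nodup := by
    refine Multiset.nodup_cons.2 ⟨?_, Finset.univ.nodup.map hfinj⟩
    intro h
    obtain ⟨z, -, hz⟩ := Multiset.mem_map.1 h
    exact (φ.symm ⟨z.1, hv _ z.2, hn _ hbσ _ z.2⟩).2 hz
  have hXcomp : ∀ y ∈ X, ∀ y' ∈ X, Comp y y' := by
    intro y hy y' hy'
    rcases (hX y).1 hy with rfl | ⟨z, rfl⟩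
    · exact Or.inr le_top
    · rcases (hX y').1 hy' with rfl | ⟨w, rfl⟩
      · exact Or.inl le_top
      · obtain ⟨h1, h2⟩ := hf z
        obtain ⟨h3, h4⟩ := hf w
        refine (hφ ⟨f z, h1⟩ ⟨f w, h3⟩).2 ?_
        rw [h2, h4]
        exact hn _ z.2 _ w.2
  obtain ⟨c, hcm, hcX⟩ := exists_monotone_of_comp X hXcard hXcomp
  have hcinj : Function.Injective c := by
    rw [← hcX] at hXnodup
    exact fun i j h => Multiset.inj_on_of_nodup_map hXnodup i (Finset.mem_univ i) j
      (Finset.mem_univ j) h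
  have hrange : ∀ y, y ∈ X ↔ ∃ j, c j = y := by
    intro y
    rw [← hcX]
    simp only [Multiset.mem_map, Finset.mem_val, Finset.mem_univ, true_and]
  have hc : StrictMono c := hcm.strictMono_of_injective hcinj
  have hbot : ⊥ ∈ X := by
    refine (hX ⊥).2 (Or.inr ⟨⟨b, hbσ⟩, ?_⟩)
    obtain ⟨h1, h2⟩ := hf ⟨b, hbσ⟩
    have h3 := hb ⟨⊥, hd⟩ rfl
    exact congrArg Subtype.val (φ.injective (Subtype.val_injective (h2.trans h3.symm)))
  refine ⟨c, hc, ?_, ?_, ?_⟩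
  · obtain ⟨j, hj⟩ := (hrange ⊥).1 hbot
    exact le_bot_iff.1 ((hcm (Fin.zero_le j)).trans_eq hj)
  · obtain ⟨j, hj⟩ := (hrange ⊤).1 ((hX ⊤).2 (Or.inl rfl))
    exact top_le_iff.1 (hj.symm.trans_le (hcm (Fin.le_last j)))
  · refine Finset.eq_of_subset_of_card_le ?_ (by rw [card_chainFace, hcard])
    intro z hz
    obtain ⟨j, -, rfl⟩ := Finset.mem_image.1 hz
    rcases (hX _).1 ((hrange _).2 ⟨j.castSucc, rfl⟩) with h | ⟨w, hw⟩
    · exact absurd h (ne_top_of_chain hc j)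
    · obtain ⟨h1, h2⟩ := hf w
      simp only [hw] at h2
      rw [h2]
      exact w.2

end Link

/-- The links of the faces with `m + 1` vertices are the joins of `m + 1` complexes of multisets of
total sum `k`. -/
theorem linkTypes_eq {k q m : ℕ} (hk : 1 ≤ k) (hkq : k ≤ q) : linkTypes k q m =
    {c | ∃ s : Fin (m + 1) → Multiset ℕ, (∀ j, 0 ∉ s j) ∧ (∀ j, s j ≠ 0) ∧
      ∑ j, (s j).sum = k ∧ c = joinType s} := by
  have hq : 1 ≤ q := hk.trans hkq
  have : NeZero q := ⟨by omega⟩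
  ext t
  constructor
  · rintro ⟨σ, hσ, hcard, rfl⟩
    obtain ⟨⟨b, hb⟩, hv, -⟩ := (mem_edgewise_faces_iff hq σ).1 hσ
    obtain ⟨x, hx, rfl⟩ := exists_isLift (hv b hb)
    obtain ⟨φ, hφb, hφ⟩ := exists_star_equiv hx
    have hsum := sum_blockSize q x
    have hd : (⊥ : Chains (blockSize (label q x))) ≠ ⊤ := by
      intro h
      have := congrArg rank h
      rw [rank_bot, rank_top] at this
      omega
    obtain ⟨c, hc, h0, h1, rfl⟩ := exists_chainFace_eq hq hφ hφb hd hσ hb hcard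
    refine ⟨gapParts c, fun j => zero_notMem_parts _, gapParts_ne_zero hc, ?_,
      combType_link hq hφ hφb hc h0 h1⟩
    rw [sum_gapParts hc h0 h1, hsum]
    omega
  · rintro ⟨s, hs, hne, hsum, rfl⟩
    -- This is where `k ≤ q` is needed: a multiset of positive numbers has at most as many elements
    -- as its sum, hence at most `q`, the number of residue classes.
    have hcard : ∀ j, (s j).card ≤ Fintype.card (ZMod q) := by
      intro j
      have h1 : (s j).card ≤ (s j).sum := by
        have := Multiset.card_nsmul_le_sum (s := s j) (a := 1) fun x hx =>
          Nat.one_le_iff_ne_zero.2 fun h0 => hs j (h0 ▸ hx)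
        simpa using this
      have h2 := Finset.single_le_sum (f := fun j => (s j).sum) (fun _ _ => Nat.zero_le _)
        (Finset.mem_univ j)
      rw [ZMod.card]
      omega
    obtain ⟨d, c, hc, h0, h1, rfl⟩ := exists_chain_gapParts_eq (ZMod q) s hs hne hcard
    rw [sum_gapParts hc h0 h1] at hsum
    obtain ⟨x, hx, rfl⟩ := exists_isLift_blockSize_eq (n := k - 1) d (by omega)
    obtain ⟨φ, hφb, hφ⟩ := exists_star_equiv hx
    exact ⟨chainFace φ hc, chainFace_mem_faces hq hφ hc, card_chainFace φ hc,
      (combType_link hq hφ hφb hc h0 h1).symm⟩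

/-! ### Counting the links -/

theorem weight_add (M N : Multiset (Multiset ℕ)) : weight (M + N) = weight M + weight N := by
  simp [weight]

/-- Each member puts its $|\sigma|-1$ either into the weight of the core or into the cone points, so
a fixed total makes the core determine the number of cone points. -/
theorem coneCount_add_weight {J : Type} [Fintype J] (s : J → Multiset ℕ) :
    coneCount s + weight (core s) = ∑ j, ((s j).sum - 1) := by
  have h : weight (core s) = ∑ j, if 2 ≤ (s j).card then (s j).sum - 1 else 0 := by
    classical
    rw [weight, core, Multiset.filter_map, Multiset.map_map, ← Finset.sum_filter]
    rfl
  rw [h, coneCount, ← Finset.sum_add_distrib]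
  refine Finset.sum_congr rfl fun j _ => ?_
  split_ifs <;> simp

theorem multiPart_of_mem_core {J : Type} [Fintype J] {s : J → Multiset ℕ} (hs : ∀ j, 0 ∉ s j)
    {σ : Multiset ℕ} (hσ : σ ∈ core s) : MultiPart σ := by
  obtain ⟨h1, h2⟩ := Multiset.mem_filter.1 hσ
  obtain ⟨j, -, rfl⟩ := Multiset.mem_map.1 h1
  exact ⟨hs j, h2⟩

theorem card_le_weight {M : Multiset (Multiset ℕ)} (hM : ∀ σ ∈ M, MultiPart σ) :
    M.card ≤ weight M := by
  have := Multiset.card_nsmul_le_sum (s := M.map fun σ => σ.sum - 1) (a := 1) fun x hx => by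
    obtain ⟨σ, hσ, rfl⟩ := Multiset.mem_map.1 hx
    have := (hM σ hσ).two_le_sum
    omega
  simpa [weight] using this

theorem exists_family {N : Multiset (Multiset ℕ)} {r : ℕ} (h : N.card = r) :
    ∃ s : Fin r → Multiset ℕ, Finset.univ.val.map s = N := by
  have e : Fin r ≃ N.ToType := Fintype.equivOfCardEq (by simp [h])
  exact ⟨fun i => (e i).1, (map_univ_eq_of_equiv (fun i => (e i).1) (fun j : N.ToType => j.1) e
    fun _ => rfl).trans (Multiset.map_univ_coe N)⟩

/-- The type of the join of the complexes of `M` and a simplex. -/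
def coneType (m : ℕ) (M : Multiset (Multiset ℕ)) : CombType :=
  -- The one-part multiset contributes `m + 1 - weight M` cone points, complementing the weight of
  -- `M` to `m + 1`; it has no zero part when `weight M ≤ m + 1`.
  joinType fun σ : (({m + 2 - weight M} : Multiset ℕ) ::ₘ M).ToType => σ.1

theorem core_cons {M : Multiset (Multiset ℕ)} (hM : ∀ σ ∈ M, MultiPart σ) (a : ℕ) :
    core (fun σ : (({a} : Multiset ℕ) ::ₘ M).ToType => σ.1) = M := by
  rw [core]
  refine (congrArg _ (Multiset.map_univ_coe _)).trans ?_
  rw [Multiset.filter_cons_of_neg _ (by simp)]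
  exact Multiset.filter_eq_self.2 fun σ hσ => (hM σ hσ).2

theorem coneCount_cons {M : Multiset (Multiset ℕ)} (hM : ∀ σ ∈ M, MultiPart σ) (a : ℕ) :
    coneCount (fun σ : (({a} : Multiset ℕ) ::ₘ M).ToType => σ.1) = a - 1 := by
  have h1 := coneCount_add_weight fun σ : (({a} : Multiset ℕ) ::ₘ M).ToType => σ.1
  rw [core_cons hM] at h1
  have h2 : ∑ σ : (({a} : Multiset ℕ) ::ₘ M).ToType, (σ.1.sum - 1) = weight ({a} ::ₘ M) := by
    conv_rhs => rw [weight, ← Multiset.map_univ_coe ({a} ::ₘ M), Multiset.map_map]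
    rfl
  have h3 : weight ({a} ::ₘ M) = a - 1 + weight M := by simp [weight]
  omega

/-! ### Links of $T_{2m+2,2m+2}$ as cones over multisets of bounded weight. -/

section Cone

variable {m : ℕ} {M : Multiset (Multiset ℕ)}

theorem positive_of_mem_cons (hM : ∀ σ ∈ M, MultiPart σ) {a : ℕ} (ha : a ≠ 0)
    {σ : Multiset ℕ} (hσ : σ ∈ ({a} : Multiset ℕ) ::ₘ M) : 0 ∉ σ ∧ σ ≠ 0 := by
  rcases Multiset.mem_cons.1 hσ with rfl | h
  · exact ⟨by simpa [eq_comm] using ha, by simp⟩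
  · exact ⟨(hM σ h).1, (hM σ h).ne_zero⟩

theorem joinType_eq_coneType_iff {J : Type} [Fintype J] {s : J → Multiset ℕ} (hs : ∀ j, 0 ∉ s j)
    (h0 : ∀ j, s j ≠ 0) (hM : ∀ σ ∈ M, MultiPart σ) (hw : weight M ≤ m + 1) :
    joinType s = coneType m M ↔ core s = M ∧ coneCount s = m + 1 - weight M := by
  have hpos := fun σ : (({m + 2 - weight M} : Multiset ℕ) ::ₘ M).ToType =>
    positive_of_mem_cons hM (a := m + 2 - weight M) (by omega) (σ := σ.1) Multiset.coe_mem
  exact (joinType_eq_iff_core hs (fun σ => (hpos σ).1) h0 fun σ => (hpos σ).2).trans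
    (and_congr (Eq.congr_right (core_cons hM _))
      (Eq.congr_right ((coneCount_cons hM _).trans (by omega))))

theorem coneType_injOn : Set.InjOn (coneType m)
    {M | (∀ σ ∈ M, MultiPart σ) ∧ weight M ≤ m + 1} := by
  rintro M ⟨hM, hw⟩ M' ⟨hM', hw'⟩ h
  have hpos := fun σ : (({m + 2 - weight M} : Multiset ℕ) ::ₘ M).ToType =>
    positive_of_mem_cons hM (a := m + 2 - weight M) (by omega) (σ := σ.1) Multiset.coe_mem
  have h1 := ((joinType_eq_coneType_iff (fun σ => (hpos σ).1) (fun σ => (hpos σ).2) hM' hw').1 h).1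
  exact (core_cons hM _).symm.trans h1

/-- Every multiset of weight at most `m + 1` is the core of `m + 1` multisets of total weight
`m + 1`. -/
theorem exists_family_core_eq (hM : ∀ σ ∈ M, MultiPart σ) (hw : weight M ≤ m + 1) :
    ∃ s : Fin (m + 1) → Multiset ℕ, (∀ j, 0 ∉ s j) ∧ (∀ j, s j ≠ 0) ∧
      ∑ j, ((s j).sum - 1) = m + 1 ∧ core s = M := by
  have hfilter : M.filter (fun σ => 2 ≤ σ.card) = M :=
    Multiset.filter_eq_self.2 fun σ hσ => (hM σ hσ).2
  have hN : ∃ N : Multiset (Multiset ℕ), N.card = m + 1 ∧ (∀ σ ∈ N, 0 ∉ σ ∧ σ ≠ 0) ∧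
      weight N = m + 1 ∧ N.filter (fun σ => 2 ≤ σ.card) = M := by
    have hc := card_le_weight hM
    -- With room left, one single part supplies the missing weight, and copies of `{1}`, whose
    -- complexes are empty, fill up the number of members. Otherwise `M.card ≤ weight M ≤ m + 1`
    -- forces both to be `m + 1`, and `M` itself serves.
    by_cases h : M.card ≤ m
    · refine ⟨({m + 2 - weight M} ::ₘ M) + Multiset.replicate (m - M.card) {1}, ?_, ?_, ?_, ?_⟩
      · rw [Multiset.card_add, Multiset.card_cons, Multiset.card_replicate]
        omega
      · intro σ hσ
        rcases Multiset.mem_add.1 hσ with h1 | h1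
        · exact positive_of_mem_cons hM (by omega) h1
        · rw [Multiset.eq_of_mem_replicate h1]
          simp
      · rw [weight_add]
        simp only [weight, Multiset.map_cons, Multiset.sum_cons, Multiset.sum_singleton,
          Multiset.map_replicate, Nat.sub_self, Multiset.sum_replicate, smul_zero] at hw ⊢
        omega
      · rw [Multiset.filter_add, Multiset.filter_cons_of_neg _ (by simp), hfilter,
          Multiset.filter_eq_nil.2, add_zero]
        intro σ hσ
        rw [Multiset.eq_of_mem_replicate hσ]
        simp
    · exact ⟨M, by omega, fun σ hσ => ⟨(hM σ hσ).1, (hM σ hσ).ne_zero⟩, by omega, hfilter⟩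
  obtain ⟨N, h1, h2, h3, h4⟩ := hN
  obtain ⟨s, rfl⟩ := exists_family h1
  have h5 : ∀ j, s j ∈ Finset.univ.val.map s := fun j =>
    Multiset.mem_map_of_mem s (Finset.mem_univ_val j)
  refine ⟨s, fun j => (h2 _ (h5 j)).1, fun j => (h2 _ (h5 j)).2, ?_, h4⟩
  rw [weight, Multiset.map_map] at h3
  exact h3

theorem one_le_sum {σ : Multiset ℕ} (h : 0 ∉ σ) (h0 : σ ≠ 0) : 1 ≤ σ.sum := by
  refine Nat.one_le_iff_ne_zero.2 fun hs => h ?_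
  obtain ⟨a, ha⟩ := Multiset.exists_mem_of_ne_zero h0
  have := Multiset.le_sum_of_mem ha
  obtain rfl : a = 0 := by omega
  exact ha

/-- The `m + 1` nonempty members each lose one, which explains the choice $k=2m+2$: the total weight
then equals the number of members. -/
theorem sum_sub_one_eq_iff {s : Fin (m + 1) → Multiset ℕ} (hs : ∀ j, 0 ∉ s j)
    (h0 : ∀ j, s j ≠ 0) : ∑ j, ((s j).sum - 1) = m + 1 ↔ ∑ j, (s j).sum = 2 * m + 2 := by
  have h : ∑ j, (s j).sum = ∑ j, ((s j).sum - 1) + (m + 1) := by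
    have : ∀ j, (s j).sum = ((s j).sum - 1) + 1 := fun j => by
      have := one_le_sum (hs j) (h0 j)
      omega
    rw [Finset.sum_congr rfl fun j _ => this j, Finset.sum_add_distrib]
    simp
  omega

theorem linkTypes_eq_image (m : ℕ) : linkTypes (2 * m + 2) (2 * m + 2) m =
    coneType m '' {M | (∀ σ ∈ M, MultiPart σ) ∧ weight M ≤ m + 1} := by
  rw [linkTypes_eq (by omega) le_rfl]
  ext c
  constructor
  · rintro ⟨s, hs, h0, hsum, rfl⟩
    have h1 := coneCount_add_weight s
    rw [(sum_sub_one_eq_iff hs h0).2 hsum] at h1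
    have hM : ∀ σ ∈ core s, MultiPart σ := fun σ => multiPart_of_mem_core hs
    exact ⟨core s, ⟨hM, by omega⟩,
      ((joinType_eq_coneType_iff hs h0 hM (by omega)).2 ⟨rfl, by omega⟩).symm⟩
  · rintro ⟨M, ⟨hM, hw⟩, rfl⟩
    obtain ⟨s, hs, h0, hsum, rfl⟩ := exists_family_core_eq hM hw
    have h1 := coneCount_add_weight s
    exact ⟨s, hs, h0, (sum_sub_one_eq_iff hs h0).1 hsum,
      ((joinType_eq_coneType_iff hs h0 hM hw).2 ⟨rfl, by omega⟩).symm⟩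

end Cone

/-- The summand `1` is the empty multiset, the only one of weight zero; in the link count it stands
for the simplex. -/
theorem encard_weight_le (t : ℕ) :
    {M | (∀ σ ∈ M, MultiPart σ) ∧ weight M ≤ t}.encard = 1 + ∑ s ∈ Finset.range t, Q s := by
  induction t with
  | zero =>
    have : {M | (∀ σ ∈ M, MultiPart σ) ∧ weight M ≤ 0} = {0} := by
      ext M
      constructor
      · rintro ⟨hM, hw⟩
        exact Multiset.card_eq_zero.1 (Nat.le_zero.1 ((card_le_weight hM).trans hw))
      · rintro rfl
        exact ⟨fun σ hσ => absurd hσ (Multiset.notMem_zero σ), le_rfl⟩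
    rw [this, Set.encard_singleton, Finset.sum_range_zero, add_zero]
  | succ t ih =>
    have : {M | (∀ σ ∈ M, MultiPart σ) ∧ weight M ≤ t + 1} =
        {M | (∀ σ ∈ M, MultiPart σ) ∧ weight M ≤ t} ∪
          {M | (∀ σ ∈ M, MultiPart σ) ∧ weight M = t + 1} := by
      ext M
      simp only [Set.mem_ofPred_eq, Set.mem_union, ← and_or_left, Nat.le_succ_iff]
    rw [this, Set.encard_union_eq, ih, ← Q_eq_encard_weight, Finset.sum_range_succ, add_assoc]
    refine Set.disjoint_left.2 ?_
    rintro M ⟨-, h1⟩ ⟨-, h2⟩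
    omega

end EdgewiseSubdivision

theorem mainTheorem11 :
    (∀ m : ℕ, (EdgewiseSubdivision.linkTypes (2 * m + 2) (2 * m + 2) m).encard =
      1 + ∑ s ∈ Finset.range (m + 1), EdgewiseSubdivision.Q s) ∧
    (∀ s : ℕ, EdgewiseSubdivision.Q s =
      ((∑ μ : (s + 1).Partition, ∏ n ∈ μ.parts.toFinset,
        Nat.multichoose (Fintype.card (n + 1).Partition - 1) (μ.parts.count n) : ℕ) : ℕ∞)) := by
  refine ⟨fun m => ?_, fun s => ?_⟩
  · rw [EdgewiseSubdivision.linkTypes_eq_image,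
      EdgewiseSubdivision.coneType_injOn.encard_image, EdgewiseSubdivision.encard_weight_le]
  · rw [EdgewiseSubdivision.Q_eq_encard_weight, EdgewiseSubdivision.encard_weight]
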